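/- All simplicial complexes are finite and abstract, and the empty set is a face of every complex; $\mathbb F$ is an arbitrary field. $V(X)$ is the vertex set of $X$, $X[A]=\{\alpha\in X:\alpha\subseteq A\}$ is the subcomplex induced on $A$, and the link of a vertex $x$ is $\mathrm{lk}_X(x)=\{\alpha\in X: x\notin\alpha,\ \alpha\cup\{x\}\in X\}$. For a finite set $\alpha$, $\overline\alpha$ (resp. $\partial\alpha$) is the complex of all (resp. all proper) subsets of $\alpha$; $*$ denotes the join. If $X$ has dimension $d$ and $\alpha,\beta$ are disjoint non-empty sets with $\#\alpha+\#\beta=d+2$ such that $X[\alpha\sqcup\beta]=\overline\alpha*\partial\beta$, then $Y=(X\setminus(\overline\alpha*\partial\beta))\cup(\partial\alpha*\overline\beta)$ (when this is a complex, as it always is for triangulated closed manifolds $X$) is obtained from $X$ by a bistellar move of index $\dim\beta=\#\beta-1$. For $0\le k\le d+1$, a $d$-dimensional complex is $k$-stellated if it is obtained from the standard sphere $S^d_{d+2}$ (the boundary complex of a simplex on $d+2$ vertices) by a finite sequence of bistellar moves, each of index $<k$. For $1\le d$ and $0\le k\le d$, $\mathcal W_k(d)$ is the class of connected $d$-dimensional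 complexes all of whose vertex links are $k$-stellated of dimension $d-1$. A complex is $2$-neighbourly if any two of its vertices form a face. For a complex $X$ with $m$ vertices, let $\beta_i(X)=\dim_{\mathbb F}H_i(X;\mathbb F)$ (simplicial homology), $\widetilde\beta_i=\beta_i$ for $i\ne0$ and $\widetilde\beta_0=\beta_0-1$ (so $\widetilde\beta_0(\{\emptyset\})=-1$), and $$\sigma_i(X)=\sum_{j=0}^m\frac1{\binom mj}\sum_{A\subseteq V(X),\ \#A=j}\widetilde\beta_i(X[A]).$$ The mu-vector of $X$ is given by $\mu_0=1$ and $\mu_i=\delta_{i1}+\frac1m\sum_{x\in V(X)}\sigma_{i-1}(\mathrm{lk}_X(x))$ for $1\le i\le\dim X$. If $X$ has dimension $d$ and $f_i$ faces of dimension $i$ ($f_{-1}=1$), its $g$-vector is $$g_j=\sum_{i=-1}^{j-1}(-1)^{j-i-1}\binom{d-i+1}{j-i-1}f_i,\qquad 0\le j\le d+1.$$ **Theorem.** Let $M\in\mathcal W_k(d)$ be $2$-neighbourly, with $d\ge 2k\ge 2$. Then the mu-vector (with respect to $\mathbb F$) and the $g$-vector of $M$ satisfy: (a) $\mu_i=0$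 for $k+1\le i\le d-k-1$; (b) $\displaystyle\sum_{i=1}^{l}(-1)^{l-i}\mu_i\le \frac{g_{l+1}}{\binom{d+2}{l+1}}$ for $1\le l\le k-1$; (c) $\displaystyle\sum_{i=1}^{l}(-1)^{l-i}\mu_i= \frac{g_{l+1}}{\binom{d+2}{l+1}}$ for $k\le l\le d-k-1$. -/

import Mathlib

/-- A finite abstract simplicial complex with vertices in `V`, given by its set of faces. As usual
in combinatorial topology, the empty set is a face of every complex. -/
@[ext]
structure FinComplex (V : Type*) where
  faces : Finset (Finset V)
  empty_mem : ∅ ∈ faces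
  down_closed : ∀ {s t : Finset V}, s ∈ faces → t ⊆ s → t ∈ faces

namespace FinComplex

section Combinatorics

variable {V : Type*} [DecidableEq V]

/-- The vertex set `V(X)`: all points lying in some face. -/
def vertices (X : FinComplex V) : Finset V := X.faces.biUnion id

/-- `X` has dimension `d`: the largest faces have exactly `d + 1` elements. -/
def HasDim (X : FinComplex V) (d : ℕ) : Prop :=
  (∃ s ∈ X.faces, s.card = d + 1) ∧ ∀ s ∈ X.faces, s.card ≤ d + 1

/-- `X` is connected: it has a vertex and any two vertices are joined by an edge path. -/
def IsConnected (X : FinComplex V) : Prop :=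
  X.vertices.Nonempty ∧ ∀ u ∈ X.vertices, ∀ v ∈ X.vertices,
    Relation.ReflTransGen (fun a b => ({a, b} : Finset V) ∈ X.faces) u v

/-- `X` is `l`-neighbourly: any `l` vertices of `X` form a face. -/
def IsNeighbourly (l : ℕ) (X : FinComplex V) : Prop :=
  ∀ s ⊆ X.vertices, s.card = l → s ∈ X.faces

/-- The induced subcomplex `X[A]`, whose faces are the faces of `X` contained in `A`. -/
def induced (X : FinComplex V) (A : Finset V) : FinComplex V where
  faces := X.faces.filter (· ⊆ A)
  empty_mem := by simp [X.empty_mem]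
  down_closed := by
    intro s t hs hts
    rw [Finset.mem_filter] at hs ⊢
    exact ⟨X.down_closed hs.1 hts, hts.trans hs.2⟩

/-- The link of the vertex `x` in `X`: all faces `s` with `x ∉ s` and `s ∪ {x} ∈ X`.
(The empty face is inserted by hand only to get a complex also when `x` is not a vertex of `X`;
if `x` is a vertex, it is in the filtered set anyway.) -/
def link (X : FinComplex V) (x : V) : FinComplex V where
  faces := insert ∅ (X.faces.filter fun s => x ∉ s ∧ insert x s ∈ X.faces)
  empty_mem := Finset.mem_insert_self _ _
  down_closed := by
    intro s t hs hts
    rw [Finset.mem_insert, Finset.mem_filter] at hs ⊢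
    rcases hs with rfl | ⟨h1, h2, h3⟩
    · exact Or.inl (Finset.subset_empty.mp hts)
    · exact Or.inr ⟨X.down_closed h1 hts, fun h => h2 (hts h),
        X.down_closed h3 (Finset.insert_subset_insert x hts)⟩

/-- The faces of the join of two complexes, given by their sets of faces. -/
def joinFaces (K L : Finset (Finset V)) : Finset (Finset V) :=
  Finset.image₂ (fun s t => s ∪ t) K L

/-- `Y` arises from the `d`-dimensional complex `X` by the bistellar move `a ↦ b`: the induced
subcomplex of `X` on `a ⊔ b` is the join of the full simplex on `a` (faces `a.powerset`) with the
boundary of the simplex on `b` (faces `b.ssubsets`), it has dimension `d`, and it is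
replaced by the join of the boundary of `a` with the full simplex on `b`. -/
def IsBistellarMove (d : ℕ) (a b : Finset V) (X Y : FinComplex V) : Prop :=
  a.Nonempty ∧ b.Nonempty ∧ Disjoint a b ∧ a.card + b.card = d + 2 ∧
    (X.induced (a ∪ b)).faces = joinFaces a.powerset b.ssubsets ∧
    Y.faces = (X.faces \ joinFaces a.powerset b.ssubsets) ∪ joinFaces a.ssubsets b.powerset

/-- `IsStellated k d X`: the complex `X` is `k`-stellated of dimension `d`, i.e. it is obtained
from a standard sphere (the boundary complex of a simplex on `d + 2` vertices) by a finite sequence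
of bistellar moves, each of index (= `dim b`) less than `k`.

All complexes of the sequence have their vertices in the type `V`. A move of index less than `d`
never deletes a vertex, so for `k ≤ d` the vertices of the whole sequence are vertices of `X` and
the choice of `V` is immaterial; for `k = d + 1` one takes `V` infinite. -/
inductive IsStellated (k d : ℕ) : FinComplex V → Prop
  | standard (X : FinComplex V) (s : Finset V) (hs : s.card = d + 2)
      (hX : X.faces = s.ssubsets) : IsStellated k d X
  | move (X Y : FinComplex V) (a b : Finset V) (hX : IsStellated k d X)
      (hmove : IsBistellarMove d a b X Y) (hindex : b.card - 1 < k) : IsStellated k d Y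

/-- The class `W_k(d)` (for `d ≥ 1`): connected complexes of dimension `d` all of whose vertex
links are `k`-stellated spheres of dimension `d - 1`. -/
structure MemW (k d : ℕ) (M : FinComplex V) : Prop where
  index_le : k ≤ d
  hasDim : M.HasDim d
  connected : M.IsConnected
  stellated_link : ∀ x ∈ M.vertices, IsStellated k (d - 1) (M.link x)

/-- The number of faces with `n` elements, i.e. the face number `f_{n-1}` in terms of dimension. -/
def numFaces (X : FinComplex V) (n : ℕ) : ℕ := (X.faces.filter fun s => s.card = n).card

/-- The component `g_j` (`0 ≤ j ≤ d + 1`) of the `g`-vector of a `d`-dimensional complex,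
`g_j = ∑_{i=-1}^{j-1} (-1)^{j-i-1} (d-i+1 choose j-i-1) f_i`, summed over `n = i + 1`. -/
def gNumber (d : ℕ) (X : FinComplex V) (j : ℕ) : ℤ :=
  ∑ n ∈ Finset.range (j + 1), (-1) ^ (j - n) * ((d + 2 - n).choose (j - n) : ℤ) * (X.numFaces n : ℤ)

end Combinatorics

noncomputable section Homology

variable {V : Type*} [LinearOrder V]

/-- The boundary operator of simplicial homology: a simplex `v₀ < ⋯ < vₙ`, `n ≥ 1`, is sent to
`∑ i, (-1)^i [v₀, …, v̂ᵢ, …, vₙ]`, and a vertex is sent to `0`. All simplices with vertices in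
`V` are treated at once; the position of `v` in `s` is the number of elements of `s` below `v`. -/
def boundary (V : Type*) [LinearOrder V] (F : Type*) [Field F] :
    (Finset V →₀ F) →ₗ[F] (Finset V →₀ F) :=
  Finsupp.lsum F fun s => LinearMap.toSpanSingleton F (Finset V →₀ F)
    (if s.card ≤ 1 then 0
     else ∑ v ∈ s, Finsupp.single (s.erase v) ((-1 : F) ^ (s.filter (· < v)).card))

/-- The space `C_i(X; F)` of simplicial `i`-chains: combinations of the `i`-dimensional faces. -/
def chains (F : Type*) [Field F] (X : FinComplex V) (i : ℕ) : Submodule F (Finset V →₀ F) :=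
  Finsupp.supported F F {s | s ∈ X.faces ∧ s.card = i + 1}

/-- The space `Z_i(X; F)` of `i`-cycles. -/
def cycles (F : Type*) [Field F] (X : FinComplex V) (i : ℕ) : Submodule F (Finset V →₀ F) :=
  X.chains F i ⊓ LinearMap.ker (boundary V F)

/-- The space `B_i(X; F)` of `i`-boundaries. -/
def boundaries (F : Type*) [Field F] (X : FinComplex V) (i : ℕ) : Submodule F (Finset V →₀ F) :=
  (X.chains F (i + 1)).map (boundary V F)

/-- The dimension of the quotient `Z / B` of two subspaces `B ≤ Z` of a vector space. -/
def quotientDim {F W : Type*} [Field F] [AddCommGroup W] [Module F W] (Z B : Submodule F W) : ℕ :=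
  Module.finrank F (Z ⧸ B.submoduleOf Z)

/-- The Betti number `β_i(X; F) = dim H_i(X; F)`, where `H_i = Z_i / B_i`. -/
def betti (F : Type*) [Field F] (X : FinComplex V) (i : ℕ) : ℕ :=
  quotientDim (X.cycles F i) (X.boundaries F i)

/-- The reduced Betti number, with `β̃_0 = β_0 - 1` and `β̃_i = β_i` for `i ≠ 0`; in particular
`β̃_0 = -1` for the complex whose only face is the empty set. -/
def reducedBetti (F : Type*) [Field F] (X : FinComplex V) (i : ℕ) : ℤ :=
  (X.betti F i : ℤ) - if i = 0 then 1 else 0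

/-- The component `σ_i` of the sigma-vector: with `m` the number of vertices,
`σ_i = ∑_{j=0}^m (m choose j)⁻¹ ∑_{A ⊆ V(X), #A = j} β̃_i(X[A])`. -/
def sigmaVec (F : Type*) [Field F] (X : FinComplex V) (i : ℕ) : ℚ :=
  ∑ j ∈ Finset.range (X.vertices.card + 1), (1 / (X.vertices.card.choose j : ℚ)) *
    ∑ A ∈ X.vertices.powersetCard j, ((X.induced A).reducedBetti F i : ℚ)

/-- The component `μ_i` of the mu-vector: `μ_0 = 1`, and
`μ_i = δ_{i1} + (1/m) ∑_{x ∈ V(X)} σ_{i-1}(lk x)` for `i ≥ 1`. -/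
def muVec (F : Type*) [Field F] (X : FinComplex V) : ℕ → ℚ
  | 0 => 1
  | i + 1 => (if i + 1 = 1 then 1 else 0) +
      (1 / (X.vertices.card : ℚ)) * ∑ x ∈ X.vertices, (X.link x).sigmaVec F i

end Homology

end FinComplex

/-! Everything is read off the vertex links by following one invariant along bistellar moves. Write
`E_l` for `eulerDefect` at `l`; on a complex with `l ≥ 1` it is the alternating sum of the reduced
Betti numbers in dimensions below `l`, so the reduced Betti number in dimension `i ≥ 1` is `E_{i+1}
+ E_i`.

Let a move `a ↦ b` in dimension `d` have index less than `k`, so `#b ≤ k`, and let `l + k ≤ d`. Then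
`#a ≥ l + 2`, and in the cardinalities seen by `E_l` the move only adds the faces `b ∪ s` with `s ⊆
a`. On a vertex set `A` this changes nothing if `b ⊄ A`. If `A` contains `b` and meets `a`, it glues
a cone along its base and keeps `E_l` (`eulerDefect_union_joinPowerset`). If `A` contains `b` and
misses `a`, the single face `b` is added: `E_l` gains `(-1)^(l - #b)` when `#b ≤ l`, may drop when
`#b = l + 1`, and is unchanged otherwise. Only `#b = l + 1` produces an inequality, and it cannot
occur when `k ≤ l`. For `k ≤ l` with `l + 1 + k ≤ d`, the changes of `E_{l+1}` and `E_l` cancel, so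
the Betti number of every induced subcomplex stays zero; this is (a).

For (b) and (c), the sets `A ⊆ W` with `b ⊆ A` and `a ∩ A = ∅`, weighted by `1 / (#W choose #A)`,
have total weight `(#W + 1) / ((d + 3) * (d + 2 choose #b))`, a Beta integral. The same move raises
`g_{#b}` by one and fixes the other `g_j` with `j < #a`. Hence the weighted sum of `E_l` is compared
with an alternating sum of `g_j / (d + 2 choose j)` (`IsStellated.sum_eulerDefect_le`).

By 2-neighbourliness the link of any vertex of `M` has one vertex fewer than `M`, so the factors `#W
+ 1` cancel the `1/m` in the mu-vector. Summed over the links, the normalized `g_j` become sums of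
consecutive normalized g-numbers of `M`, and the alternating sum telescopes to one g-number; the
leftover `g_0 = 1` cancels against `δ_{i1}`. -/

namespace FinComplex

/-! ### Chain spaces of families of finite sets -/

section FamilyChains

variable {V : Type*} (F : Type*) [Field F]

/-- The chains supported on the members of cardinality `n` of a family of finite sets. -/
def familyChains (K : Finset (Finset V)) (n : ℕ) : Submodule F (Finset V →₀ F) :=
  Finsupp.supported F F {s | s ∈ K ∧ s.card = n}

theorem familyChains_eq_span (K : Finset (Finset V)) (n : ℕ) :
    familyChains F K n = Submodule.span F
      ((fun s => Finsupp.single s (1 : F)) '' {s | s ∈ K ∧ s.card = n}) :=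
  Finsupp.supported_eq_span_single F _

instance finiteDimensional_familyChains (K : Finset (Finset V)) (n : ℕ) :
    FiniteDimensional F (familyChains F K n) := by
  rw [familyChains_eq_span]
  refine FiniteDimensional.span_of_finite F (Set.Finite.image _ ?_)
  exact K.finite_toSet.subset fun s hs => hs.1

theorem finrank_familyChains (K : Finset (Finset V)) (n : ℕ) :
    Module.finrank F (familyChains F K n) = (K.filter fun s => s.card = n).card := by
  have : {s | s ∈ K ∧ s.card = n} = ((K.filter fun s => s.card = n : Finset _) : Set (Finset V)) := by
    ext; simp
  rw [familyChains, this, (Finsupp.supportedEquivFinsupp _).finrank_eq]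
  simp

end FamilyChains

/-! ### The boundary operator and its rank -/

section BoundaryRank

variable {V : Type*} [LinearOrder V] (F : Type*) [Field F]

theorem boundary_single_of_card_le {s : Finset V} (hs : s.card ≤ 1) :
    boundary V F (Finsupp.single s 1) = 0 := by
  simp [boundary, hs]

theorem boundary_single {s : Finset V} (hs : 1 < s.card) :
    boundary V F (Finsupp.single s 1) =
      ∑ v ∈ s, Finsupp.single (s.erase v) ((-1 : F) ^ (s.filter (· < v)).card) := by
  simp [boundary, not_le.mpr hs]

theorem boundary_single_apply {s : Finset V} (hs : 1 < s.card) (t : Finset V) :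
    boundary V F (Finsupp.single s 1) t =
      ∑ v ∈ s, if s.erase v = t then (-1 : F) ^ (s.filter (· < v)).card else 0 := by
  rw [boundary_single F hs, Finsupp.finsetSum_apply]
  simp [Finsupp.single_apply]

theorem boundary_single_apply_erase {s : Finset V} (hs : 1 < s.card) {v : V} (hv : v ∈ s) :
    boundary V F (Finsupp.single s 1) (s.erase v) = (-1 : F) ^ (s.filter (· < v)).card := by
  rw [boundary_single_apply F hs, Finset.sum_eq_single_of_mem v hv, if_pos rfl]
  intro w hw hwv
  refine if_neg fun h => ?_
  have : w ∈ s.erase w := h ▸ Finset.mem_erase.mpr ⟨hwv, hw⟩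
  simp at this

theorem boundary_single_apply_eq_zero {s t : Finset V} (h : ∀ v ∈ s, s.erase v ≠ t) :
    boundary V F (Finsupp.single s 1) t = 0 := by
  by_cases hs : s.card ≤ 1
  · simp [boundary_single_of_card_le F hs]
  · rw [boundary_single_apply F (not_le.mp hs)]
    exact Finset.sum_eq_zero fun v hv => if_neg (h v hv)

/-- Deleting the smaller vertex `v` lowers the position of `w` by one; deleting `w` leaves that of
`v` alone. -/
theorem neg_one_pow_card_lt_mul_swap {s : Finset V} {v w : V} (hv : v ∈ s) (h : v < w) :
    (-1 : F) ^ (s.filter (· < v)).card * (-1) ^ ((s.erase v).filter (· < w)).card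
      + (-1) ^ (s.filter (· < w)).card * (-1) ^ ((s.erase w).filter (· < v)).card = 0 := by
  have h1 : (s.erase w).filter (· < v) = s.filter (· < v) := by
    ext x
    simp only [Finset.mem_filter, Finset.mem_erase]
    constructor
    · rintro ⟨⟨-, h1⟩, h2⟩; exact ⟨h1, h2⟩
    · rintro ⟨h1, h2⟩; exact ⟨⟨(h2.trans h).ne, h1⟩, h2⟩
  have h2 : (s.filter (· < w)).card = ((s.erase v).filter (· < w)).card + 1 := by
    rw [Finset.filter_erase, Finset.card_erase_add_one]
    simp [hv, h]
  rw [h1, h2]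
  ring

theorem boundary_boundary_single (s : Finset V) :
    boundary V F (boundary V F (Finsupp.single s 1)) = 0 := by
  by_cases hs1 : s.card ≤ 1
  · simp [boundary_single_of_card_le F hs1]
  have hsingle : ∀ (t : Finset V) (c : F), Finsupp.single t c = c • Finsupp.single t (1 : F) := by
    intro t c; simp
  rw [boundary_single F (not_le.mp hs1), map_sum]
  -- For an edge nothing needs to cancel: its facets are vertices, whose boundary is zero by
  -- convention.
  by_cases hs2 : s.card ≤ 2
  · refine Finset.sum_eq_zero fun v hv => ?_
    rw [hsingle, map_smul, boundary_single_of_card_le F, smul_zero]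
    rw [Finset.card_erase_of_mem hv]; omega
  have hterm : ∀ v ∈ s, boundary V F
      (Finsupp.single (s.erase v) ((-1 : F) ^ (s.filter (· < v)).card)) =
      ∑ w ∈ s.erase v, Finsupp.single ((s.erase v).erase w)
        ((-1 : F) ^ (s.filter (· < v)).card * (-1) ^ ((s.erase v).filter (· < w)).card) := by
    intro v hv
    rw [hsingle, map_smul, boundary_single F, Finset.smul_sum]
    · simp
    · rw [Finset.card_erase_of_mem hv]; omega
  rw [Finset.sum_congr rfl hterm, Finset.sum_sigma']
  refine Finset.sum_involution (fun p _ => ⟨p.2, p.1⟩) ?_ ?_ ?_ ?_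
  · rintro ⟨v, w⟩ hp
    simp only [Finset.mem_sigma, Finset.mem_erase] at hp
    obtain ⟨hv, hwv, hw⟩ := hp
    simp only
    rw [Finset.erase_right_comm (a := w) (b := v), ← Finsupp.single_add]
    rcases lt_or_gt_of_ne hwv with h | h
    · rw [add_comm, neg_one_pow_card_lt_mul_swap F hw h, Finsupp.single_zero]
    · rw [neg_one_pow_card_lt_mul_swap F hv h, Finsupp.single_zero]
  · rintro ⟨v, w⟩ hp - h
    simp only [Finset.mem_sigma, Finset.mem_erase] at hp
    simp only [Sigma.mk.injEq] at h
    exact hp.2.1 h.1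
  · rintro ⟨v, w⟩ hp
    simp only [Finset.mem_sigma, Finset.mem_erase] at hp ⊢
    exact ⟨hp.2.2, hp.2.1.symm, hp.1⟩
  · rintro ⟨v, w⟩ hp
    rfl

/-- The rank of the boundary operator on the chains of cardinality `n` of a family. -/
noncomputable def boundaryRank (K : Finset (Finset V)) (n : ℕ) : ℕ :=
  Module.finrank F ((familyChains F K n).map (boundary V F))

theorem map_boundary_familyChains (K : Finset (Finset V)) (n : ℕ) :
    (familyChains F K n).map (boundary V F) = Submodule.span F
      ((fun s => boundary V F (Finsupp.single s (1 : F))) '' {s | s ∈ K ∧ s.card = n}) := by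
  rw [familyChains_eq_span, Submodule.map_span, Set.image_image]

theorem boundaryRank_of_le_one (K : Finset (Finset V)) {n : ℕ} (hn : n ≤ 1) :
    boundaryRank F K n = 0 := by
  have : (familyChains F K n).map (boundary V F) = ⊥ := by
    rw [map_boundary_familyChains, Submodule.span_eq_bot]
    rintro _ ⟨s, hs, rfl⟩
    exact boundary_single_of_card_le F (hs.2.le.trans hn)
  rw [boundaryRank, this, finrank_bot]

theorem boundaryRank_congr {K L : Finset (Finset V)} {n : ℕ}
    (h : ∀ s, s.card = n → (s ∈ K ↔ s ∈ L)) : boundaryRank F K n = boundaryRank F L n := by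
  have : {s | s ∈ K ∧ s.card = n} = {s | s ∈ L ∧ s.card = n} := by
    ext s
    simp only [Set.mem_ofPred_eq]
    constructor <;> rintro ⟨h1, h2⟩
    · exact ⟨(h s h2).1 h1, h2⟩
    · exact ⟨(h s h2).2 h1, h2⟩
  rw [boundaryRank, boundaryRank, familyChains, familyChains, this]

/-- Adjoining vectors which are independent modulo `U`, as witnessed by coordinate functionals
vanishing on `U`, raises the dimension by their number. -/
theorem finrank_sup_span_of_dual {E ι : Type*} [AddCommGroup E] [Module F E] [DecidableEq ι]
    (U : Submodule F E) [FiniteDimensional F U] (T : Finset ι) (u : ι → E) (φ : ι → E →ₗ[F] F)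
    (hU : ∀ i ∈ T, ∀ x ∈ U, φ i x = 0) (hu : ∀ i ∈ T, φ i (u i) ≠ 0)
    (huu : ∀ i ∈ T, ∀ j ∈ T, i ≠ j → φ i (u j) = 0) :
    Module.finrank F ↥(U ⊔ Submodule.span F (u '' (T : Set ι))) = Module.finrank F U + T.card := by
  induction T using Finset.induction_on with
  | empty => rw [Finset.coe_empty, Set.image_empty, Submodule.span_empty, sup_bot_eq]; simp
  | insert i T hi ih =>
    have ih' := ih (fun j hj => hU j (Finset.mem_insert_of_mem hj))
      (fun j hj => hu j (Finset.mem_insert_of_mem hj))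
      (fun j hj l hl => huu j (Finset.mem_insert_of_mem hj) l (Finset.mem_insert_of_mem hl))
    have hfin : FiniteDimensional F (Submodule.span F (u '' (T : Set ι))) :=
      FiniteDimensional.span_of_finite F (T.finite_toSet.image u)
    have hle : U ⊔ Submodule.span F (u '' (T : Set ι)) ≤ LinearMap.ker (φ i) := by
      refine sup_le (fun x hx => hU i (Finset.mem_insert_self _ _) x hx) ?_
      rw [Submodule.span_le]
      rintro _ ⟨j, hj, rfl⟩
      refine huu i (Finset.mem_insert_self _ _) j (Finset.mem_insert_of_mem hj) ?_
      rintro rfl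
      exact hi hj
    have hnot : u i ∉ U ⊔ Submodule.span F (u '' (T : Set ι)) := fun h =>
      hu i (Finset.mem_insert_self _ _) (hle h)
    rw [Finset.coe_insert, Set.image_insert_eq, Submodule.span_insert,
      sup_comm (Submodule.span F {u i}), ← sup_assoc, Finset.card_insert_of_notMem hi]
    have hdisj : Disjoint (U ⊔ Submodule.span F (u '' (T : Set ι))) (Submodule.span F {u i}) := by
      rw [Submodule.disjoint_span_singleton' (by rintro h; simp [h] at hnot)]
      exact hnot
    have h := Submodule.finrank_sup_add_finrank_inf_eq
      (U ⊔ Submodule.span F (u '' (T : Set ι))) (Submodule.span F {u i})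
    rw [hdisj.eq_bot, finrank_bot, ih', finrank_span_singleton
      (by rintro h; simp [h] at hnot)] at h
    omega

end BoundaryRank

/-! ### Alternating sums -/

section AlternatingSum

/-- The alternating sum `f l - f (l - 1) + f (l - 2) - ⋯ ± f 0`. -/
def alternatingSum {R : Type*} [Ring R] (f : ℕ → R) : ℕ → R
  | 0 => f 0
  | l + 1 => f (l + 1) - alternatingSum f l

variable {R : Type*} [Ring R]

theorem alternatingSum_add (f g : ℕ → R) (l : ℕ) :
    alternatingSum (fun n => f n + g n) l = alternatingSum f l + alternatingSum g l := by
  induction l with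
  | zero => rfl
  | succ l ih => simp only [alternatingSum, ih]; abel

theorem alternatingSum_congr {f g : ℕ → R} {l : ℕ} (h : ∀ n ≤ l, f n = g n) :
    alternatingSum f l = alternatingSum g l := by
  induction l with
  | zero => exact h 0 le_rfl
  | succ l ih =>
    rw [alternatingSum, alternatingSum, h _ le_rfl, ih fun n hn => h n (hn.trans l.le_succ)]

theorem alternatingSum_zero (l : ℕ) : alternatingSum (fun _ => (0 : R)) l = 0 := by
  induction l with
  | zero => rfl
  | succ l ih => simp [alternatingSum, ih]

theorem alternatingSum_single (p : ℕ) (x : R) (l : ℕ) :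
    alternatingSum (fun n => if n = p then x else 0) l =
      if p ≤ l then (-1) ^ (l - p) * x else 0 := by
  induction l with
  | zero => rcases p with _ | p <;> simp [alternatingSum]
  | succ l ih =>
    rw [alternatingSum, ih]
    rcases lt_trichotomy p (l + 1) with h | rfl | h
    · rw [if_neg (by omega), if_pos (by omega), if_pos (by omega), Nat.succ_sub (by omega), pow_succ]
      simp
    · simp
    · rw [if_neg (by omega), if_neg (by omega), if_neg (by omega), sub_zero]

end AlternatingSum

/-! ### The Euler defect and its behaviour under adding faces -/

section EulerDefect

variable {V : Type*} [LinearOrder V] (F : Type*) [Field F]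

/-- The alternating sum of the face numbers of a family up to cardinality `l`, diminished by the
rank of the boundary operator on its members of cardinality `l + 1`. For `l ≥ 1` and a simplicial
complex, this is the alternating sum of its reduced Betti numbers in dimensions less than `l`. -/
noncomputable def eulerDefect (K : Finset (Finset V)) (l : ℕ) : ℤ :=
  alternatingSum (fun n => ((K.filter fun s => s.card = n).card : ℤ)) l - boundaryRank F K (l + 1)

theorem eulerDefect_congr {K L : Finset (Finset V)} {l : ℕ}
    (h : ∀ s, s.card ≤ l + 1 → (s ∈ K ↔ s ∈ L)) : eulerDefect F K l = eulerDefect F L l := by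
  rw [eulerDefect, eulerDefect, boundaryRank_congr F fun s hs => h s hs.le]
  congr 1
  refine alternatingSum_congr fun n hn => ?_
  congr 2
  ext s
  simp only [Finset.mem_filter, and_congr_left_iff]
  exact fun hs => h s (by omega)

theorem eulerDefect_empty {l : ℕ} : eulerDefect F (∅ : Finset (Finset V)) l = 0 := by
  have : boundaryRank F (∅ : Finset (Finset V)) (l + 1) = 0 := by
    have h : {s : Finset V | s ∈ (∅ : Finset (Finset V)) ∧ s.card = l + 1} = ∅ := by ext; simp
    rw [boundaryRank, map_boundary_familyChains, h, Set.image_empty, Submodule.span_empty,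
      finrank_bot]
  simp [eulerDefect, this, alternatingSum_zero]

/-- All sets `b ∪ s` with `s ⊆ c`. -/
def joinPowerset (b c : Finset V) : Finset (Finset V) := c.powerset.image (b ∪ ·)

theorem mem_joinPowerset {b c t : Finset V} : t ∈ joinPowerset b c ↔ ∃ s ⊆ c, b ∪ s = t := by
  simp [joinPowerset]

theorem joinPowerset_empty (b : Finset V) : joinPowerset b ∅ = {b} := by
  simp [joinPowerset]

variable {K : Finset (Finset V)} {b c : Finset V} {v : V}

/-- The new faces form a cone with apex `v` over those avoiding `v`. Since `∂∂ = 0` on `insert v t`,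
the boundary of a new face `t` avoiding `v` is a combination of boundaries of old faces and of new
faces through `v`. -/
theorem map_boundary_union_joinPowerset (hv : v ∈ c) (hbc : Disjoint b c)
    (hbd : ∀ s ⊆ c, ∀ y ∈ b, b.erase y ∪ s ∈ K) (n : ℕ) (hn : 2 ≤ n) :
    (familyChains F (K ∪ joinPowerset b c) n).map (boundary V F) =
      (familyChains F K n).map (boundary V F) ⊔
        Submodule.span F ((fun s => boundary V F (Finsupp.single s (1 : F))) ''
          ((joinPowerset b c).filter fun s => s.card = n ∧ v ∈ s : Finset _)) := by
  apply le_antisymm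
  · rw [map_boundary_familyChains, map_boundary_familyChains, Submodule.span_le]
    rintro _ ⟨t, ⟨ht, htn⟩, rfl⟩
    rw [Finset.mem_union, mem_joinPowerset] at ht
    rcases ht with ht | ⟨s, hs, rfl⟩
    · exact Submodule.mem_sup_left (Submodule.subset_span ⟨t, ⟨ht, htn⟩, rfl⟩)
    by_cases hvs : v ∈ s
    · refine Submodule.mem_sup_right (Submodule.subset_span ⟨b ∪ s, ?_, rfl⟩)
      simp only [Finset.coe_filter, Set.mem_ofPred_eq, mem_joinPowerset]
      exact ⟨⟨s, hs, rfl⟩, htn, Finset.mem_union_right _ hvs⟩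
    have hvb : v ∉ b := fun h => Finset.disjoint_left.mp hbc h hv
    have hvt : v ∉ b ∪ s := by simp [hvb, hvs]
    have hbb := boundary_boundary_single F (insert v (b ∪ s))
    rw [boundary_single F (by rw [Finset.card_insert_of_notMem hvt]; omega), map_sum,
      Finset.sum_insert hvt, Finset.erase_insert hvt] at hbb
    have hsingle : ∀ (t : Finset V) (x : F),
        Finsupp.single t x = x • Finsupp.single t (1 : F) := by
      intro t x; simp
    rw [hsingle (b ∪ s), map_smul] at hbb
    simp only [SetLike.mem_coe]
    -- The coefficient of the face without `v` is a sign, hence invertible, so `∂∂ = 0` can be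
    -- solved for its boundary.
    rw [← Submodule.smul_mem_iff _ (pow_ne_zero
      ((insert v (b ∪ s)).filter (· < v)).card (neg_ne_zero.mpr (one_ne_zero (α := F)))),
      eq_neg_of_add_eq_zero_left hbb]
    refine Submodule.neg_mem _ (Submodule.sum_mem _ fun w hw => ?_)
    rw [hsingle, map_smul]
    refine Submodule.smul_mem _ _ ?_
    have hvw : v ≠ w := by rintro rfl; exact hvt hw
    have hcard : ((insert v (b ∪ s)).erase w).card = n := by
      rw [Finset.card_erase_of_mem (Finset.mem_insert_of_mem hw),
        Finset.card_insert_of_notMem hvt, htn, Nat.add_sub_cancel]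
    rcases Finset.mem_union.mp hw with hwb | hws
    · refine Submodule.mem_sup_left (Submodule.subset_span ⟨_, ⟨?_, hcard⟩, rfl⟩)
      have hws : w ∉ s := fun h => Finset.disjoint_left.mp hbc hwb (hs h)
      convert hbd (insert v s) (Finset.insert_subset hv hs) w hwb using 1
      ext x
      simp only [Finset.mem_erase, Finset.mem_insert, Finset.mem_union]
      constructor
      · rintro ⟨h1, h2 | h2 | h2⟩ <;> simp [*]
      · rintro (⟨h1, h2⟩ | rfl | h2)
        · simp [*]
        · simp [*]
        · exact ⟨fun h => hws (h ▸ h2), Or.inr (Or.inr h2)⟩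
    · refine Submodule.mem_sup_right (Submodule.subset_span ⟨_, ?_, rfl⟩)
      have hwb : w ∉ b := fun h => Finset.disjoint_left.mp hbc h (hs hws)
      simp only [Finset.coe_filter, Set.mem_ofPred_eq, mem_joinPowerset]
      refine ⟨⟨(insert v s).erase w, (Finset.erase_subset _ _).trans
        (Finset.insert_subset hv hs), ?_⟩, hcard, by simp [hvw]⟩
      rw [← Finset.union_insert, Finset.erase_union_distrib, Finset.erase_eq_of_notMem hwb]
  · refine sup_le (Submodule.map_mono (Finsupp.supported_mono ?_)) ?_
    · rintro s ⟨hs, hsn⟩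
      exact ⟨Finset.mem_union_left _ hs, hsn⟩
    · rw [map_boundary_familyChains]
      refine Submodule.span_mono (Set.image_mono ?_)
      intro s hs
      simp only [Finset.coe_filter, Set.mem_ofPred_eq] at hs
      exact ⟨Finset.mem_union_right _ hs.1, hs.2.1⟩

/-- The boundaries of the new faces `t` through `v` are independent modulo the old ones: the
coordinate at `t.erase v` detects `t` alone. That set still contains `b`, so it is no facet of an
old face, and `t` is the only face through `v` having it as a facet. -/
theorem boundaryRank_union_joinPowerset (hv : v ∈ c) (hbc : Disjoint b c)
    (hK : ∀ t ∈ K, ¬ b ⊆ t) (hbd : ∀ s ⊆ c, ∀ y ∈ b, b.erase y ∪ s ∈ K) (n : ℕ) (hn : 2 ≤ n) :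
    boundaryRank F (K ∪ joinPowerset b c) n =
      boundaryRank F K n + ((joinPowerset b c).filter fun s => s.card = n ∧ v ∈ s).card := by
  have hvb : v ∉ b := fun h => Finset.disjoint_left.mp hbc h hv
  rw [boundaryRank, boundaryRank, map_boundary_union_joinPowerset F hv hbc hbd n hn]
  refine finrank_sup_span_of_dual F _ _ _ (fun t => Finsupp.lapply (t.erase v)) ?_ ?_ ?_
  · intro t ht x hx
    obtain ⟨s, hs, rfl⟩ := mem_joinPowerset.mp (Finset.mem_filter.mp ht).1
    rw [← LinearMap.mem_ker]
    refine (?_ : (familyChains F K n).map (boundary V F) ≤ _) hx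
    rw [map_boundary_familyChains, Submodule.span_le]
    rintro _ ⟨r, ⟨hr, -⟩, rfl⟩
    rw [SetLike.mem_coe, LinearMap.mem_ker, Finsupp.lapply_apply]
    refine boundary_single_apply_eq_zero F fun w hw h => hK r hr ?_
    intro y hy
    have : y ∈ (b ∪ s).erase v := by
      rw [Finset.mem_erase]
      exact ⟨fun h => hvb (h ▸ hy), Finset.mem_union_left _ hy⟩
    rw [← h] at this
    exact Finset.mem_of_mem_erase this
  · intro t ht
    rw [Finset.mem_filter] at ht
    rw [Finsupp.lapply_apply, boundary_single_apply_erase F (by omega) ht.2.2]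
    exact pow_ne_zero _ (neg_ne_zero.mpr one_ne_zero)
  · intro t ht r hr htr
    rw [Finset.mem_filter] at ht hr
    rw [Finsupp.lapply_apply]
    refine boundary_single_apply_eq_zero F fun w hw h => htr ?_
    have hwv : w = v := by
      by_contra hne
      have : v ∈ r.erase w := Finset.mem_erase.mpr ⟨fun h => hne h.symm, hr.2.2⟩
      rw [h] at this
      simp at this
    subst hwv
    rw [← Finset.insert_erase hw, h, Finset.insert_erase ht.2.2]

theorem card_filter_joinPowerset_notMem (hv : v ∈ c) (hbc : Disjoint b c) (n : ℕ) :
    ((joinPowerset b c).filter fun s => s.card = n ∧ v ∉ s).card =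
      ((joinPowerset b c).filter fun s => s.card = n + 1 ∧ v ∈ s).card := by
  have hvb : v ∉ b := fun h => Finset.disjoint_left.mp hbc h hv
  refine Finset.card_bij' (fun s _ => insert v s) (fun s _ => s.erase v) ?_ ?_ ?_ ?_
  · intro t ht
    simp only [Finset.mem_filter, mem_joinPowerset] at ht ⊢
    obtain ⟨⟨s, hs, rfl⟩, hn, hvt⟩ := ht
    refine ⟨⟨insert v s, Finset.insert_subset hv hs, Finset.union_insert _ _ _⟩, ?_, by simp⟩
    rw [Finset.card_insert_of_notMem hvt, hn]
  · intro t ht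
    simp only [Finset.mem_filter, mem_joinPowerset] at ht ⊢
    obtain ⟨⟨s, hs, rfl⟩, hn, hvt⟩ := ht
    refine ⟨⟨s.erase v, (Finset.erase_subset _ _).trans hs, ?_⟩, ?_, by simp⟩
    · rw [Finset.erase_union_distrib, Finset.erase_eq_of_notMem hvb]
    · rw [Finset.card_erase_of_mem hvt, hn, Nat.add_sub_cancel]
  · intro t ht
    exact Finset.erase_insert (Finset.mem_filter.mp ht).2.2
  · intro t ht
    exact Finset.insert_erase (Finset.mem_filter.mp ht).2.2

theorem card_filter_union_joinPowerset (hK : ∀ t ∈ K, ¬ b ⊆ t) (n : ℕ) :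
    ((K ∪ joinPowerset b c).filter fun s => s.card = n).card =
      (K.filter fun s => s.card = n).card +
        ((joinPowerset b c).filter fun s => s.card = n).card := by
  rw [Finset.filter_union, Finset.card_union_of_disjoint]
  refine Finset.disjoint_filter_filter (Finset.disjoint_left.mpr fun t ht ht' => ?_)
  obtain ⟨s, hs, rfl⟩ := mem_joinPowerset.mp ht'
  exact hK _ ht Finset.subset_union_left

/-- Gluing a cone along its base does not change the Euler defect. -/
theorem eulerDefect_union_joinPowerset (hc : c.Nonempty) (hbc : Disjoint b c)
    (hK : ∀ t ∈ K, ¬ b ⊆ t) (hbd : ∀ s ⊆ c, ∀ y ∈ b, b.erase y ∪ s ∈ K) {l : ℕ} (hl : 1 ≤ l) :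
    eulerDefect F (K ∪ joinPowerset b c) l = eulerDefect F K l := by
  obtain ⟨v, hv⟩ := hc
  rw [eulerDefect, eulerDefect, boundaryRank_union_joinPowerset F hv hbc hK hbd _ (by omega)]
  -- Pairing `t` with `insert v t` makes the alternating face count telescope to the faces through
  -- `v` of cardinality `l + 1`, which is exactly the increase of the rank.
  have hsplit : ∀ n, ((joinPowerset b c).filter fun s => s.card = n).card =
      ((joinPowerset b c).filter fun s => s.card = n ∧ v ∈ s).card +
        ((joinPowerset b c).filter fun s => s.card = n + 1 ∧ v ∈ s).card := by
    intro n
    rw [← card_filter_joinPowerset_notMem hv hbc, ← Finset.filter_filter, ← Finset.filter_filter,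
      Finset.card_filter_add_card_filter_not]
  have hsum : alternatingSum
      (fun n => (((joinPowerset b c).filter fun s => s.card = n).card : ℤ)) l =
      ((joinPowerset b c).filter fun s => s.card = l + 1 ∧ v ∈ s).card := by
    clear hl
    induction l with
    | zero =>
      have : ((joinPowerset b c).filter fun s => s.card = 0 ∧ v ∈ s) = ∅ := by
        refine Finset.filter_eq_empty_iff.mpr fun s _ h => ?_
        rw [Finset.card_eq_zero] at h
        simp [h.1] at h
      rw [alternatingSum, hsplit, this]
      simp
    | succ l ih => rw [alternatingSum, ih, hsplit]; push_cast; ring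
  simp only [card_filter_union_joinPowerset hK]
  push_cast
  rw [alternatingSum_add, hsum]
  ring

theorem boundaryRank_mono {K L : Finset (Finset V)} (h : K ⊆ L) (n : ℕ) :
    boundaryRank F K n ≤ boundaryRank F L n :=
  Submodule.finrank_mono (Submodule.map_mono (Finsupp.supported_mono fun _ hs => ⟨h hs.1, hs.2⟩))

theorem alternatingSum_card_filter_insert (hb : b ∉ K) (l : ℕ) :
    alternatingSum (fun n => (((insert b K).filter fun s => s.card = n).card : ℤ)) l =
      alternatingSum (fun n => ((K.filter fun s => s.card = n).card : ℤ)) l +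
        if b.card ≤ l then (-1) ^ (l - b.card) else 0 := by
  have h : ∀ n, (((insert b K).filter fun s => s.card = n).card : ℤ) =
      (K.filter fun s => s.card = n).card + if n = b.card then 1 else 0 := by
    intro n
    rw [Finset.filter_insert]
    by_cases hn : b.card = n
    · rw [if_pos hn, if_pos hn.symm, Finset.card_insert_of_notMem (by simp [hb])]
      push_cast; rfl
    · rw [if_neg hn, if_neg (Ne.symm hn), add_zero]
  simp only [h]
  rw [alternatingSum_add, alternatingSum_single]
  simp

theorem eulerDefect_insert_of_card_ne (hb : b ∉ K) {l : ℕ} (hl : b.card ≠ l + 1) :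
    eulerDefect F (insert b K) l =
      eulerDefect F K l + if b.card ≤ l then (-1) ^ (l - b.card) else 0 := by
  rw [eulerDefect, eulerDefect, alternatingSum_card_filter_insert hb,
    boundaryRank_congr F (K := insert b K) (L := K)]
  · ring
  · intro s hs
    rw [Finset.mem_insert, or_iff_right]
    rintro rfl
    exact hl hs

/-- In the critical cardinality `b.card = l + 1`, the face `b` is not counted but may raise the
rank; monotonicity of the rank is all that is used. -/
theorem eulerDefect_insert_le (hb : b ∉ K) (l : ℕ) :
    eulerDefect F (insert b K) l ≤
      eulerDefect F K l + if b.card ≤ l then (-1) ^ (l - b.card) else 0 := by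
  rw [eulerDefect, eulerDefect, alternatingSum_card_filter_insert hb]
  have := boundaryRank_mono F (Finset.subset_insert b K) (l + 1)
  have : (boundaryRank F K (l + 1) : ℤ) ≤ boundaryRank F (insert b K) (l + 1) := by exact_mod_cast this
  linarith

end EulerDefect

/-! ### Reduced Betti numbers from Euler defects -/

section Betti

variable {V : Type*} [LinearOrder V] (F : Type*) [Field F]

theorem quotientDim_add {W : Type*} [AddCommGroup W] [Module F W] {Z B : Submodule F W}
    [FiniteDimensional F Z] (h : B ≤ Z) :
    quotientDim Z B + Module.finrank F B = Module.finrank F Z := by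
  rw [quotientDim, ← Submodule.finrank_quotient_add_finrank (B.submoduleOf Z),
    (Submodule.submoduleOfEquivOfLe h).finrank_eq]

theorem boundaries_le_cycles (X : FinComplex V) (i : ℕ) : X.boundaries F i ≤ X.cycles F i := by
  refine le_inf ?_ ?_
  · rw [boundaries]
    change (familyChains F X.faces (i + 2)).map _ ≤ _
    rw [map_boundary_familyChains, Submodule.span_le]
    rintro _ ⟨s, ⟨hs, hsn⟩, rfl⟩
    change boundary V F (Finsupp.single s 1) ∈ X.chains F i
    rw [boundary_single F (by omega)]
    refine Submodule.sum_mem _ fun v hv => ?_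
    refine Finsupp.single_mem_supported F _ ⟨X.down_closed hs (Finset.erase_subset _ _), ?_⟩
    rw [Finset.card_erase_of_mem hv]
    omega
  · rw [boundaries]
    change (familyChains F X.faces (i + 2)).map _ ≤ _
    rw [map_boundary_familyChains, Submodule.span_le]
    rintro _ ⟨s, -, rfl⟩
    exact boundary_boundary_single F s

theorem finrank_cycles_add (X : FinComplex V) (i : ℕ) :
    Module.finrank F (X.cycles F i) + boundaryRank F X.faces (i + 1) =
      (X.faces.filter fun s => s.card = i + 1).card := by
  have h := LinearMap.finrank_range_add_finrank_ker (K := F) (V := familyChains F X.faces (i + 1))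
    ((boundary V F).domRestrict (familyChains F X.faces (i + 1)))
  rw [LinearMap.range_domRestrict, LinearMap.ker_domRestrict, finrank_familyChains,
    ← Submodule.finrank_map_subtype_eq, Submodule.map_comap_subtype] at h
  rw [← h, add_comm]
  rfl

theorem betti_add (X : FinComplex V) (i : ℕ) :
    X.betti F i + boundaryRank F X.faces (i + 2) + boundaryRank F X.faces (i + 1) =
      (X.faces.filter fun s => s.card = i + 1).card := by
  have : FiniteDimensional F (X.cycles F i) :=
    have : FiniteDimensional F (X.chains F i) := finiteDimensional_familyChains F X.faces (i + 1)
    Submodule.finiteDimensional_of_le (inf_le_left : X.cycles F i ≤ X.chains F i)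
  rw [← finrank_cycles_add F, ← quotientDim_add F (boundaries_le_cycles F X i)]
  rfl

theorem filter_card_eq_zero (X : FinComplex V) : X.faces.filter (fun s => s.card = 0) = {∅} := by
  ext s
  simp only [Finset.mem_filter, Finset.card_eq_zero, Finset.mem_singleton, and_iff_right_iff_imp]
  rintro rfl
  exact X.empty_mem

/-- The empty face, counted in the alternating sum, accounts for the `-1` in the reduced Betti
number. -/
theorem reducedBetti_zero (X : FinComplex V) :
    X.reducedBetti F 0 = eulerDefect F X.faces 1 := by
  have h := congrArg (Nat.cast : ℕ → ℤ) (betti_add F X 0)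
  rw [boundaryRank_of_le_one F _ le_rfl] at h
  simp only [reducedBetti, eulerDefect, alternatingSum, filter_card_eq_zero, if_true]
  simp at h ⊢
  linarith

theorem reducedBetti_succ (X : FinComplex V) (i : ℕ) :
    X.reducedBetti F (i + 1) = eulerDefect F X.faces (i + 2) + eulerDefect F X.faces (i + 1) := by
  have h := congrArg (Nat.cast : ℕ → ℤ) (betti_add F X (i + 1))
  rw [Nat.cast_add, Nat.cast_add] at h
  simp only [reducedBetti, eulerDefect, alternatingSum]
  simp at h ⊢
  linarith

end Betti

/-! ### Binomial identities -/

section Counting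

/-- Among the subsets `A` of `W`, weighted by the inverse of `#W choose #A`, those containing `B`
and missing `C` have total weight `(#W + 1) / ((#B + #C + 1) * (#B + #C choose #B))`. -/
theorem sum_powerset_indicator_div_choose {V : Type*} [DecidableEq V] (W B C : Finset V)
    (hB : B ⊆ W) (hC : C ⊆ W) (hBC : Disjoint B C) :
    ∑ A ∈ W.powerset, (if B ⊆ A ∧ Disjoint C A then 1 else 0 : ℚ) / W.card.choose A.card =
      (W.card + 1 : ℚ) / ((B.card + C.card + 1) * (B.card + C.card).choose B.card) := by
  induction hn : (W \ (B ∪ C)).card generalizing B C with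
  | zero =>
    rw [Finset.card_eq_zero, Finset.sdiff_eq_empty_iff_subset] at hn
    have hW : W = B ∪ C := hn.antisymm (Finset.union_subset hB hC)
    have hcard : W.card = B.card + C.card := by rw [hW, Finset.card_union_of_disjoint hBC]
    rw [Finset.sum_eq_single B]
    · rw [if_pos ⟨subset_rfl, hBC.symm⟩, hcard]
      have : ((B.card + C.card).choose B.card : ℚ) ≠ 0 := by
        exact_mod_cast (Nat.choose_pos (Nat.le_add_right _ _)).ne'
      have : (B.card + C.card + 1 : ℚ) ≠ 0 := by positivity
      push_cast
      field_simp
    · intro A hA hAB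
      rw [if_neg, zero_div]
      rintro ⟨h1, h2⟩
      refine hAB (Finset.Subset.antisymm (fun x hx => ?_) h1)
      have := Finset.mem_powerset.mp hA hx
      rw [hW, Finset.mem_union] at this
      exact this.resolve_right fun h => Finset.disjoint_left.mp h2 h hx
    · intro h
      exact absurd (Finset.mem_powerset.mpr hB) h
  | succ n ih =>
    -- An element outside `B ∪ C` is unconstrained: split the sum according to whether it lies in
    -- `A`, which enlarges `B` or `C`.
    obtain ⟨x, hx⟩ : (W \ (B ∪ C)).Nonempty := by
      rw [← Finset.card_pos]; omega
    simp only [Finset.mem_sdiff, Finset.mem_union, not_or] at hx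
    obtain ⟨hxW, hxB, hxC⟩ := hx
    have hcard : (W \ insert x (B ∪ C)).card = n := by
      rw [Finset.sdiff_insert, Finset.card_erase_of_mem (by simp [hxW, hxB, hxC]), hn,
        Nat.add_sub_cancel]
    have h1 := ih (insert x B) C (Finset.insert_subset hxW hB) hC
      (Finset.disjoint_insert_left.mpr ⟨hxC, hBC⟩) (by rw [Finset.insert_union, hcard])
    have h2 := ih B (insert x C) hB (Finset.insert_subset hxW hC)
      (Finset.disjoint_insert_right.mpr ⟨hxB, hBC⟩) (by rw [Finset.union_insert, hcard])
    have hsplit : ∀ A : Finset V, (if B ⊆ A ∧ Disjoint C A then 1 else 0 : ℚ) =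
        (if insert x B ⊆ A ∧ Disjoint C A then 1 else 0) +
          (if B ⊆ A ∧ Disjoint (insert x C) A then 1 else 0) := by
      intro A
      simp only [Finset.insert_subset_iff, Finset.disjoint_insert_left]
      by_cases hxA : x ∈ A <;> simp [hxA]
    simp only [hsplit, add_div]
    rw [Finset.sum_add_distrib, h1, h2, Finset.card_insert_of_notMem hxB,
      Finset.card_insert_of_notMem hxC]
    set p := B.card
    set q := C.card
    have e1 : (((p + q + 1).choose (p + 1) : ℕ) : ℚ) * (p + 1) = (p + q + 1) * (p + q).choose p := by
      exact_mod_cast (Nat.add_one_mul_choose_eq (p + q) p).symm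
    have e2 : (((p + q + 1).choose p : ℕ) : ℚ) * (q + 1) = (p + q + 1) * (p + q).choose p := by
      have := Nat.choose_mul_succ_eq (p + q) p
      rw [show p + q + 1 - p = q + 1 by omega] at this
      have h : (((p + q).choose p * (p + q + 1) : ℕ) : ℚ) = _ := congrArg Nat.cast this
      push_cast at h
      linarith
    have h0 : ((p + q).choose p : ℚ) ≠ 0 := by
      exact_mod_cast (Nat.choose_pos (Nat.le_add_right _ _)).ne'
    rw [show p + 1 + q = p + q + 1 by ring, show p + (q + 1) = p + q + 1 by ring]
    have e1' : (((p + q + 1).choose (p + 1) : ℕ) : ℚ) = (p + q + 1) * (p + q).choose p / (p + 1) := by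
      rw [← e1]; field_simp
    have e2' : (((p + q + 1).choose p : ℕ) : ℚ) = (p + q + 1) * (p + q).choose p / (q + 1) := by
      rw [← e2]; field_simp
    rw [e1', e2']
    have h3 : (p + q + 1 : ℚ) ≠ 0 := by positivity
    have h4 : (p + q + 2 : ℚ) ≠ 0 := by positivity
    have h5 : (p + 1 + q + 1 : ℚ) = p + q + 2 := by ring
    have h6 : (p + (q + 1) + 1 : ℚ) = p + q + 2 := by ring
    push_cast
    rw [h5, h6]
    field_simp
    ring

theorem sum_neg_one_pow_mul_choose_mul_choose (N r : ℕ) :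
    ∑ i ∈ Finset.range (r + 1), (-1 : ℤ) ^ (r - i) * (N - i).choose (r - i) * N.choose i =
      if r = 0 then 1 else 0 := by
  by_cases hr : r ≤ N
  swap
  · rw [if_neg (by omega)]
    refine Finset.sum_eq_zero fun i hi => ?_
    rw [Finset.mem_range] at hi
    rcases lt_or_ge N i with h | h
    · simp [Nat.choose_eq_zero_of_lt h]
    · simp [Nat.choose_eq_zero_of_lt (show N - i < r - i by omega)]
  have h : ∀ i ∈ Finset.range (r + 1),
      (-1 : ℤ) ^ (r - i) * (N - i).choose (r - i) * N.choose i =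
        (-1) ^ r * N.choose r * ((-1) ^ i * r.choose i) := by
    intro i hi
    have hi' : i ≤ r := by rw [Finset.mem_range] at hi; omega
    have h1 : (N.choose r * r.choose i : ℤ) = N.choose i * (N - i).choose (r - i) := by
      exact_mod_cast Nat.choose_mul hi'
    have h2 : (-1 : ℤ) ^ (r - i) = (-1) ^ r * (-1) ^ i := by
      obtain ⟨j, rfl⟩ := Nat.exists_eq_add_of_le hi'
      rw [Nat.add_sub_cancel_left, pow_add, mul_right_comm, ← mul_pow]
      simp
    rw [h2]
    linear_combination (-1) ^ r * (-1) ^ i * (-h1)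
  rw [Finset.sum_congr rfl h, ← Finset.mul_sum, Int.alternating_sum_range_choose]
  by_cases h0 : r = 0
  · simp [h0]
  · simp [h0]

/-- The passage from face numbers to g-numbers inverts a binomial transform. The faces `b ∪ s`, `s ⊆
a`, with `b.card = p` and `a.card = e - p` therefore contribute a unit vector. -/
theorem sum_neg_one_pow_mul_choose_shift {e p j : ℕ} (f : ℕ → ℤ)
    (hf : ∀ n ≤ j, f n = if p ≤ n then ((e - p).choose (n - p) : ℤ) else 0) :
    ∑ n ∈ Finset.range (j + 1), (-1) ^ (j - n) * ((e - n).choose (j - n) : ℤ) * f n =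
      if j = p then 1 else 0 := by
  rcases lt_or_ge j p with hjp | hjp
  · rw [if_neg hjp.ne]
    refine Finset.sum_eq_zero fun n hn => ?_
    rw [Finset.mem_range] at hn
    rw [hf n (by omega), if_neg (by omega), mul_zero]
  obtain ⟨r, rfl⟩ := Nat.exists_eq_add_of_le hjp
  rw [Finset.range_eq_Ico, ← Finset.sum_Ico_consecutive _ (Nat.zero_le p) (by omega),
    Finset.sum_eq_zero, zero_add, Finset.sum_Ico_eq_sum_range]
  · rw [show p + r + 1 - p = r + 1 by omega]
    have := sum_neg_one_pow_mul_choose_mul_choose (e - p) r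
    simp only [show (p + r = p) ↔ r = 0 by omega]
    rw [← this]
    refine Finset.sum_congr rfl fun i hi => ?_
    rw [Finset.mem_range] at hi
    rw [hf _ (by omega), if_pos (by omega), show p + r - (p + i) = r - i by omega,
      show e - (p + i) = e - p - i by omega, Nat.add_sub_cancel_left]
  · intro n hn
    rw [Finset.mem_Ico] at hn
    rw [hf n (by omega), if_neg (by omega), mul_zero]

end Counting

/-! ### Effect of one bistellar move, and the standard sphere -/

section BistellarMove

variable {V : Type*} [LinearOrder V] {d : ℕ} {a b : Finset V} {X Y : FinComplex V}

theorem mem_joinFaces {K L : Finset (Finset V)} {t : Finset V} :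
    t ∈ joinFaces K L ↔ ∃ u ∈ K, ∃ w ∈ L, u ∪ w = t := by
  simp [joinFaces, Finset.mem_image₂]

theorem mem_faces_induced {X : FinComplex V} {A t : Finset V} :
    t ∈ (X.induced A).faces ↔ t ∈ X.faces ∧ t ⊆ A := by
  simp [induced]

theorem mem_vertices {X : FinComplex V} {x : V} : x ∈ X.vertices ↔ {x} ∈ X.faces := by
  simp only [vertices, Finset.mem_biUnion, id]
  exact ⟨fun ⟨s, hs, hx⟩ => X.down_closed hs (by simpa using hx), fun h => ⟨_, h, by simp⟩⟩

namespace IsBistellarMove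

theorem union_mem (h : IsBistellarMove d a b X Y) {s w : Finset V} (hs : s ⊆ a) (hw : w ⊂ b) :
    s ∪ w ∈ X.faces := by
  have : s ∪ w ∈ (X.induced (a ∪ b)).faces := by
    rw [h.2.2.2.2.1, mem_joinFaces]
    exact ⟨s, Finset.mem_powerset.mpr hs, w, Finset.mem_ssubsets.mpr hw, rfl⟩
  exact (mem_faces_induced.mp this).1

theorem not_subset (h : IsBistellarMove d a b X Y) {t : Finset V} (ht : t ∈ X.faces) :
    ¬ b ⊆ t := by
  intro hbt
  have : b ∈ (X.induced (a ∪ b)).faces :=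
    mem_faces_induced.mpr ⟨X.down_closed ht hbt, Finset.subset_union_right⟩
  rw [h.2.2.2.2.1, mem_joinFaces] at this
  obtain ⟨u, hu, w, hw, huw⟩ := this
  rw [Finset.mem_powerset] at hu
  rw [Finset.mem_ssubsets] at hw
  refine hw.2 fun y hy => ?_
  have hy' := hy
  rw [← huw, Finset.mem_union] at hy'
  exact hy'.resolve_left fun hyu => Finset.disjoint_left.mp h.2.2.1 (hu hyu) hy

/-- The faces lost in a move all contain `a`, so below cardinality `a.card` the move only adds
faces. -/
theorem mem_faces_iff (h : IsBistellarMove d a b X Y) {t : Finset V} (ht : t.card < a.card) :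
    t ∈ Y.faces ↔ t ∈ X.faces ∨ t ∈ joinPowerset b a := by
  have hne : ∀ u ⊆ t, u ≠ a := fun u hu hua => by
    have := Finset.card_le_card hu
    rw [hua] at this
    omega
  rw [h.2.2.2.2.2, Finset.mem_union, Finset.mem_sdiff, mem_joinFaces, mem_joinFaces,
    mem_joinPowerset]
  constructor
  · rintro (⟨h1, -⟩ | ⟨u, hu, w, hw, rfl⟩)
    · exact Or.inl h1
    · rw [Finset.mem_ssubsets] at hu
      rw [Finset.mem_powerset] at hw
      rcases hw.eq_or_ssubset with rfl | hw
      · exact Or.inr ⟨u, hu.1, Finset.union_comm _ _⟩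
      · exact Or.inl (h.union_mem hu.1 hw)
  · rintro (h1 | ⟨s, hs, rfl⟩)
    · by_cases hJ : ∃ u ∈ a.powerset, ∃ w ∈ b.ssubsets, u ∪ w = t
      · obtain ⟨u, hu, w, hw, rfl⟩ := hJ
        rw [Finset.mem_powerset] at hu
        rw [Finset.mem_ssubsets] at hw
        exact Or.inr ⟨u, Finset.mem_ssubsets.mpr
          (hu.ssubset_of_ne (hne u Finset.subset_union_left)), w,
          Finset.mem_powerset.mpr hw.1, rfl⟩
      · exact Or.inl ⟨h1, hJ⟩
    · exact Or.inr ⟨s, Finset.mem_ssubsets.mpr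
        (hs.ssubset_of_ne (hne s Finset.subset_union_right)), b,
        Finset.mem_powerset_self b, Finset.union_comm _ _⟩

theorem erase_union_mem (h : IsBistellarMove d a b X Y) {s : Finset V} (hs : s ⊆ a) {y : V}
    (hy : y ∈ b) : b.erase y ∪ s ∈ X.faces := by
  rw [Finset.union_comm]
  exact h.union_mem hs (Finset.erase_ssubset hy)

theorem vertices_subset (h : IsBistellarMove d a b X Y) (ha : 2 ≤ a.card) :
    X.vertices ⊆ Y.vertices := by
  intro x hx
  rw [mem_vertices] at hx ⊢
  exact (h.mem_faces_iff (by rw [Finset.card_singleton]; omega)).mpr (Or.inl hx)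

theorem union_subset_vertices (h : IsBistellarMove d a b X Y) (ha : 2 ≤ a.card) :
    a ∪ b ⊆ Y.vertices := by
  have key : ∀ x ∈ a, {x} ∪ b ∈ Y.faces := by
    intro x hx
    rw [h.2.2.2.2.2, Finset.mem_union]
    refine Or.inr (mem_joinFaces.mpr ⟨{x}, Finset.mem_ssubsets.mpr ?_, b, Finset.mem_powerset_self b, rfl⟩)
    refine (Finset.singleton_subset_iff.mpr hx).ssubset_of_ne ?_
    rintro rfl
    simp at ha
  obtain ⟨x, hx⟩ := h.1
  intro y hy
  rw [mem_vertices]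
  rcases Finset.mem_union.mp hy with hy | hy
  · exact Y.down_closed (key y hy) Finset.subset_union_left
  · exact Y.down_closed (key x hx) (by simp [hy])

theorem numFaces_eq (h : IsBistellarMove d a b X Y) {n : ℕ} (hn : n < a.card) :
    Y.numFaces n = X.numFaces n + if b.card ≤ n then a.card.choose (n - b.card) else 0 := by
  have h1 : (Y.faces.filter fun s => s.card = n) =
      (X.faces ∪ joinPowerset b a).filter fun s => s.card = n := by
    ext t
    simp only [Finset.mem_filter, Finset.mem_union, and_congr_left_iff]
    rintro rfl
    exact h.mem_faces_iff hn
  rw [numFaces, numFaces, h1, card_filter_union_joinPowerset fun t ht => h.not_subset ht]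
  congr 1
  have hcard : ∀ s ⊆ a, (b ∪ s).card = b.card + s.card := fun s hs =>
    Finset.card_union_of_disjoint (h.2.2.1.symm.mono_right hs)
  split_ifs with hb
  · rw [← Finset.card_powersetCard]
    symm
    refine Finset.card_bij (fun s _ => b ∪ s) ?_ ?_ ?_
    · intro s hs
      rw [Finset.mem_powersetCard] at hs
      rw [Finset.mem_filter, mem_joinPowerset, hcard s hs.1]
      exact ⟨⟨s, hs.1, rfl⟩, by omega⟩
    · intro s hs t ht hst
      rw [Finset.mem_powersetCard] at hs ht
      have key : ∀ r ⊆ a, (b ∪ r) \ b = r := fun r hr =>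
        Finset.union_sdiff_cancel_left (h.2.2.1.symm.mono_right hr)
      rw [← key s hs.1, hst, key t ht.1]
    · intro t ht
      rw [Finset.mem_filter, mem_joinPowerset] at ht
      obtain ⟨⟨s, hs, rfl⟩, hn⟩ := ht
      rw [hcard s hs] at hn
      exact ⟨s, Finset.mem_powersetCard.mpr ⟨hs, by omega⟩, rfl⟩
  · rw [Finset.card_eq_zero, Finset.filter_eq_empty_iff]
    intro t ht hn
    obtain ⟨s, hs, rfl⟩ := mem_joinPowerset.mp ht
    rw [hcard s hs] at hn
    omega

theorem gNumber_eq (h : IsBistellarMove d a b X Y) {j : ℕ} (hj : j < a.card) :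
    Y.gNumber d j = X.gNumber d j + if j = b.card then 1 else 0 := by
  have hab := h.2.2.2.1
  rw [gNumber, gNumber, ← sum_neg_one_pow_mul_choose_shift (e := d + 2)
    (fun n => if b.card ≤ n then ((d + 2 - b.card).choose (n - b.card) : ℤ) else 0)
    (fun n _ => rfl), ← Finset.sum_add_distrib]
  refine Finset.sum_congr rfl fun n hn => ?_
  rw [Finset.mem_range] at hn
  rw [h.numFaces_eq (by omega), ← hab, Nat.add_sub_cancel]
  push_cast
  ring

variable (F : Type*) [Field F]

/-- The cases are `b ⊄ A` (no change), `a ∩ A` nonempty (a cone is glued along its base) and `a ∩ A`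
empty (the one face `b` is inserted). The bound on `l` keeps all relevant faces below `a.card`. -/
theorem eulerDefect_induced (h : IsBistellarMove d a b X Y) (A : Finset V) {l : ℕ} (hl : 1 ≤ l)
    (hla : l + 1 < a.card) :
    eulerDefect F (Y.induced A).faces l ≤ eulerDefect F (X.induced A).faces l +
        (if b ⊆ A ∧ Disjoint a A then 1 else 0) * (if b.card ≤ l then (-1) ^ (l - b.card) else 0) ∧
    (b.card ≠ l + 1 →
      eulerDefect F (Y.induced A).faces l = eulerDefect F (X.induced A).faces l +
        (if b ⊆ A ∧ Disjoint a A then 1 else 0) *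
          (if b.card ≤ l then (-1) ^ (l - b.card) else 0)) := by
  have hK : ∀ t ∈ (X.induced A).faces, ¬ b ⊆ t := fun t ht =>
    h.not_subset (mem_faces_induced.mp ht).1
  by_cases hbA : b ⊆ A
  · have h1 : eulerDefect F (Y.induced A).faces l =
        eulerDefect F ((X.induced A).faces ∪ joinPowerset b (a ∩ A)) l := by
      refine eulerDefect_congr F fun t ht => ?_
      rw [Finset.mem_union, mem_faces_induced, mem_faces_induced,
        h.mem_faces_iff (by omega), or_and_right]
      refine or_congr Iff.rfl ?_
      rw [mem_joinPowerset, mem_joinPowerset]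
      constructor
      · rintro ⟨⟨s, hs, rfl⟩, hA⟩
        exact ⟨s, Finset.subset_inter hs (Finset.subset_union_right.trans hA), rfl⟩
      · rintro ⟨s, hs, rfl⟩
        exact ⟨⟨s, hs.trans Finset.inter_subset_left, rfl⟩,
          Finset.union_subset hbA (hs.trans Finset.inter_subset_right)⟩
    rw [h1]
    rcases (a ∩ A).eq_empty_or_nonempty with hc | hc
    · rw [if_pos ⟨hbA, Finset.disjoint_iff_inter_eq_empty.mpr hc⟩, one_mul, hc,
        joinPowerset_empty, Finset.union_comm, ← Finset.insert_eq]
      have hbX : b ∉ (X.induced A).faces := fun hb => hK b hb subset_rfl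
      exact ⟨eulerDefect_insert_le F hbX l, fun hne => eulerDefect_insert_of_card_ne F hbX hne⟩
    · rw [if_neg fun hh => Finset.nonempty_iff_ne_empty.mp hc
        (Finset.disjoint_iff_inter_eq_empty.mp hh.2), zero_mul, add_zero,
        eulerDefect_union_joinPowerset F hc (h.2.2.1.symm.mono_right Finset.inter_subset_left) hK
          (fun s hs y hy => mem_faces_induced.mpr
            ⟨h.erase_union_mem (hs.trans Finset.inter_subset_left) hy, ?_⟩) hl]
      · exact ⟨le_rfl, fun _ => rfl⟩
      · exact Finset.union_subset ((Finset.erase_subset _ _).trans hbA)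
          (hs.trans Finset.inter_subset_right)
  · have h1 : eulerDefect F (Y.induced A).faces l = eulerDefect F (X.induced A).faces l := by
      refine eulerDefect_congr F fun t ht => ?_
      rw [mem_faces_induced, mem_faces_induced, h.mem_faces_iff (by omega), or_and_right,
        or_iff_left]
      rintro ⟨hj, htA⟩
      obtain ⟨s, hs, rfl⟩ := mem_joinPowerset.mp hj
      exact hbA (Finset.subset_union_left.trans htA)
    rw [h1, if_neg fun hh => hbA hh.1, zero_mul, add_zero]
    exact ⟨le_rfl, fun _ => rfl⟩

end IsBistellarMove

section StandardSphere

variable {s : Finset V}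

theorem numFaces_standardSphere (hs : s.card = d + 2) (hX : X.faces = s.ssubsets)
    {n : ℕ} (hn : n ≤ d + 1) :
    X.numFaces n = (d + 2).choose n := by
  rw [numFaces, ← hs, ← Finset.card_powersetCard]
  congr 1
  ext t
  rw [Finset.mem_filter, hX, Finset.mem_ssubsets, Finset.mem_powersetCard]
  refine ⟨fun h => ⟨h.1.1, h.2⟩, fun h => ⟨h.1.ssubset_of_ne ?_, h.2⟩⟩
  rintro rfl
  omega

theorem gNumber_standardSphere (hs : s.card = d + 2) (hX : X.faces = s.ssubsets)
    {j : ℕ} (hj : j ≤ d + 1) :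
    X.gNumber d j = if j = 0 then 1 else 0 := by
  rw [gNumber, sum_neg_one_pow_mul_choose_shift (e := d + 2) (p := 0)]
  intro n hn
  rw [numFaces_standardSphere hs hX (hn.trans hj)]
  simp

/-- As `l ≤ d`, the missing top face `s` is too large to matter, so the induced complex acts as the
full simplex on `s ∩ A`. If nonempty, this is a cone glued to the empty family; otherwise only the
empty face remains. -/
theorem eulerDefect_induced_standardSphere (hs : s.card = d + 2) (hX : X.faces = s.ssubsets)
    (F : Type*) [Field F] (A : Finset V) {l : ℕ} (hl : 1 ≤ l) (hld : l ≤ d) :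
    eulerDefect F (X.induced A).faces l = if Disjoint s A then (-1) ^ l else 0 := by
  have h1 : eulerDefect F (X.induced A).faces l =
      eulerDefect F ((∅ : Finset (Finset V)) ∪ joinPowerset ∅ (s ∩ A)) l := by
    refine eulerDefect_congr F fun t ht => ?_
    rw [Finset.empty_union, mem_faces_induced, hX, Finset.mem_ssubsets, mem_joinPowerset]
    constructor
    · rintro ⟨h1, h2⟩
      exact ⟨t, Finset.subset_inter h1.1 h2, Finset.empty_union _⟩
    · rintro ⟨r, hr, rfl⟩
      rw [Finset.empty_union] at ht ⊢
      refine ⟨(hr.trans Finset.inter_subset_left).ssubset_of_ne ?_,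
        hr.trans Finset.inter_subset_right⟩
      rintro rfl
      omega
  rw [h1]
  rcases (s ∩ A).eq_empty_or_nonempty with hc | hc
  · rw [if_pos (Finset.disjoint_iff_inter_eq_empty.mpr hc), hc, joinPowerset_empty,
      Finset.union_comm, ← Finset.insert_eq,
      eulerDefect_insert_of_card_ne F (Finset.notMem_empty _) (by simp), eulerDefect_empty]
    simp
  · rw [if_neg fun hh => Finset.nonempty_iff_ne_empty.mp hc
      (Finset.disjoint_iff_inter_eq_empty.mp hh),
      eulerDefect_union_joinPowerset F hc (Finset.disjoint_empty_left _) (by simp) (by simp) hl,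
      eulerDefect_empty]

end StandardSphere

end BistellarMove

/-! ### Linearity and telescoping of alternating sums -/

section AlternatingSumLinear

variable {R : Type*} [Ring R]

theorem alternatingSum_mul_left (x : R) (f : ℕ → R) (l : ℕ) :
    alternatingSum (fun n => x * f n) l = x * alternatingSum f l := by
  induction l with
  | zero => rfl
  | succ l ih => simp only [alternatingSum, ih, mul_sub]

theorem alternatingSum_sum {ι : Type*} (s : Finset ι) (f : ι → ℕ → R) (l : ℕ) :
    alternatingSum (fun n => ∑ i ∈ s, f i n) l = ∑ i ∈ s, alternatingSum (f i) l := by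
  induction l with
  | zero => rfl
  | succ l ih => simp only [alternatingSum, ih, Finset.sum_sub_distrib]

theorem alternatingSum_add_succ (f : ℕ → R) (l : ℕ) :
    alternatingSum (fun n => f n + f (n + 1)) l = f (l + 1) + (-1) ^ l * f 0 := by
  induction l with
  | zero => simp [alternatingSum, add_comm]
  | succ l ih => rw [alternatingSum, ih, pow_succ, mul_neg_one, neg_mul]; abel

theorem sum_Icc_neg_one_pow_mul (f : ℕ → R) (l : ℕ) :
    ∑ i ∈ Finset.Icc 1 (l + 1), (-1) ^ (l + 1 - i) * f i =
      alternatingSum (fun i => f (i + 1)) l := by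
  induction l with
  | zero => simp [alternatingSum]
  | succ l ih =>
    rw [Finset.sum_Icc_succ_top (by omega), alternatingSum, ← ih, Nat.sub_self, pow_zero, one_mul,
      add_comm, sub_eq_add_neg, ← Finset.sum_neg_distrib]
    congr 1
    refine Finset.sum_congr rfl fun i hi => ?_
    rw [Finset.mem_Icc] at hi
    rw [Nat.succ_sub (by omega), pow_succ]
    simp

end AlternatingSumLinear

/-! ### Induction along the moves of a stellated sphere -/

section StellatedSphere

variable {V : Type*} [LinearOrder V] (F : Type*) [Field F]

theorem alternatingSum_sigmaVec (X : FinComplex V) (l : ℕ) :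
    alternatingSum (X.sigmaVec F) l = ∑ A ∈ X.vertices.powerset,
      (eulerDefect F (X.induced A).faces (l + 1) : ℚ) / X.vertices.card.choose A.card := by
  have h : ∀ i, X.sigmaVec F i = ∑ A ∈ X.vertices.powerset,
      ((X.induced A).reducedBetti F i : ℚ) / X.vertices.card.choose A.card := by
    intro i
    rw [Finset.sum_powerset, sigmaVec]
    refine Finset.sum_congr rfl fun j _ => ?_
    rw [Finset.mul_sum]
    refine Finset.sum_congr rfl fun A hA => ?_
    rw [(Finset.mem_powersetCard.mp hA).2]
    ring
  induction l with
  | zero => simp only [alternatingSum, h, reducedBetti_zero]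
  | succ l ih =>
    rw [alternatingSum, ih, h, ← Finset.sum_sub_distrib]
    refine Finset.sum_congr rfl fun A _ => ?_
    rw [reducedBetti_succ]
    push_cast
    ring

variable {k d : ℕ} {X : FinComplex V}

/-- Each move has `b.card ≤ k ≤ l`, so it changes the two defects by opposite signs; the standard
sphere starts the induction with opposite values. -/
theorem IsStellated.eulerDefect_add_eq_zero (hX : IsStellated k d X) (A : Finset V) {l : ℕ}
    (hl : 1 ≤ l) (hkl : k ≤ l) (hld : l + 1 + k ≤ d) :
    eulerDefect F (X.induced A).faces (l + 1) + eulerDefect F (X.induced A).faces l = 0 := by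
  induction hX with
  | standard X s hs hX =>
    rw [eulerDefect_induced_standardSphere hs hX F A (by omega) (by omega),
      eulerDefect_induced_standardSphere hs hX F A hl (by omega)]
    split_ifs
    · rw [pow_succ]; ring
    · rfl
  | move X Y a b hX hmove hindex ih =>
    have hb := hmove.2.1.card_pos
    have hab := hmove.2.2.2.1
    have hbl : b.card ≤ l := by omega
    rw [(hmove.eulerDefect_induced F A (l := l + 1) (by omega) (by omega)).2 (by omega),
      (hmove.eulerDefect_induced F A hl (by omega)).2 (by omega), if_pos (hbl.trans l.le_succ),
      if_pos hbl, Nat.succ_sub hbl, pow_succ]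
    linear_combination ih

/-- The weighted sum of the Euler defects of the induced subcomplexes is bounded by the
alternating sum of normalized `g`-numbers, with equality in dimensions at least `k`. -/
theorem IsStellated.sum_eulerDefect_le (hX : IsStellated k d X) {l : ℕ} (hl : 1 ≤ l)
    (hld : l + k ≤ d) (W : Finset V) (hW : X.vertices ⊆ W) :
    ∑ A ∈ W.powerset, (eulerDefect F (X.induced A).faces l : ℚ) / W.card.choose A.card ≤
        (W.card + 1) / (d + 3) *
          alternatingSum (fun j => (X.gNumber d j : ℚ) / (d + 2).choose j) l ∧
      (k ≤ l →
        ∑ A ∈ W.powerset, (eulerDefect F (X.induced A).faces l : ℚ) / W.card.choose A.card =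
          (W.card + 1) / (d + 3) *
            alternatingSum (fun j => (X.gNumber d j : ℚ) / (d + 2).choose j) l) := by
  induction hX with
  | standard X s hs hX =>
    -- The set `W` is fixed throughout the induction, since the weights depend on its size. The
    -- standard sphere behaves like a move with `b = ∅` and `a = s`.
    have hsW : s ⊆ W := by
      intro x hx
      refine hW (mem_vertices.mpr ?_)
      rw [hX, Finset.mem_ssubsets]
      refine (Finset.singleton_subset_iff.mpr hx).ssubset_of_ne ?_
      rintro rfl
      simp at hs
    have h1 := sum_powerset_indicator_div_choose W ∅ s (by simp) hsW (by simp)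
    rw [hs, Finset.card_empty, Nat.choose_zero_right] at h1
    have h2 : ∀ A ∈ W.powerset,
        (eulerDefect F (X.induced A).faces l : ℚ) / W.card.choose A.card =
          (-1) ^ l * ((if ∅ ⊆ A ∧ Disjoint s A then 1 else 0 : ℚ) / W.card.choose A.card) := by
      intro A _
      rw [eulerDefect_induced_standardSphere hs hX F A hl (by omega)]
      by_cases h : Disjoint s A <;> simp [h]
      ring
    have h3 : alternatingSum (fun j => (X.gNumber d j : ℚ) / (d + 2).choose j) l = (-1) ^ l := by
      rw [alternatingSum_congr (g := fun j => if j = 0 then (1 : ℚ) else 0),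
        alternatingSum_single]
      · simp
      · intro j hj
        rw [gNumber_standardSphere hs hX (by omega)]
        by_cases h : j = 0 <;> simp [h]
    have h4 : ∑ A ∈ W.powerset, (eulerDefect F (X.induced A).faces l : ℚ) / W.card.choose A.card =
        (W.card + 1) / (d + 3) *
          alternatingSum (fun j => (X.gNumber d j : ℚ) / (d + 2).choose j) l := by
      rw [Finset.sum_congr rfl h2, ← Finset.mul_sum, h1, h3]
      push_cast
      rw [show (0 + (d + 2 : ℚ) + 1) = d + 3 by ring]
      ring
    exact ⟨h4.le, fun _ => h4⟩
  | move X Y a b hX hmove hindex ih =>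
    have hb := hmove.2.1.card_pos
    have hab := hmove.2.2.2.1
    -- From `b.card ≤ k`, `a.card + b.card = d + 2` and `l + k ≤ d`. In particular no vertex is
    -- lost, so `W` also contains the vertices of `X`.
    have hla : l + 1 < a.card := by omega
    have habW := (hmove.union_subset_vertices (by omega)).trans hW
    obtain ⟨ih1, ih2⟩ := ih ((hmove.vertices_subset (by omega)).trans hW)
    set ε : ℚ := if b.card ≤ l then (-1) ^ (l - b.card) else 0 with hε
    have hε' : (((if b.card ≤ l then (-1) ^ (l - b.card) else 0 : ℤ)) : ℚ) = ε := by
      rw [hε]; push_cast; rfl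
    have hweight := sum_powerset_indicator_div_choose W b a (Finset.union_subset_right habW)
      (Finset.union_subset_left habW) hmove.2.2.1.symm
    rw [add_comm b.card a.card, hab] at hweight
    have hba : (b.card + a.card + 1 : ℚ) = d + 3 := by
      have : ((a.card + b.card : ℕ) : ℚ) = (d + 2 : ℕ) := by rw [hab]
      push_cast at this
      linarith
    rw [hba] at hweight
    have hg : alternatingSum (fun j => (Y.gNumber d j : ℚ) / (d + 2).choose j) l =
        alternatingSum (fun j => (X.gNumber d j : ℚ) / (d + 2).choose j) l +
          ε / (d + 2).choose b.card := by
      rw [alternatingSum_congr (g := fun j => (X.gNumber d j : ℚ) / (d + 2).choose j +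
        if j = b.card then (1 / (d + 2).choose b.card : ℚ) else 0), alternatingSum_add,
        alternatingSum_single, hε]
      · congr 1
        split_ifs <;> ring
      · intro j hj
        rw [hmove.gNumber_eq (by omega)]
        by_cases h : j = b.card <;> simp [h, add_div]
    have hsum : ∑ A ∈ W.powerset, ((eulerDefect F (X.induced A).faces l : ℚ) +
          (if b ⊆ A ∧ Disjoint a A then 1 else 0) * ε) / W.card.choose A.card =
        ∑ A ∈ W.powerset, (eulerDefect F (X.induced A).faces l : ℚ) / W.card.choose A.card +
          ε * ((W.card + 1) / ((d + 3) * (d + 2).choose b.card)) := by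
      rw [← hweight, Finset.mul_sum, ← Finset.sum_add_distrib]
      refine Finset.sum_congr rfl fun A _ => ?_
      ring
    have hR : (W.card + 1 : ℚ) / (d + 3) *
        (alternatingSum (fun j => (X.gNumber d j : ℚ) / (d + 2).choose j) l +
          ε / (d + 2).choose b.card) =
        (W.card + 1) / (d + 3) *
          alternatingSum (fun j => (X.gNumber d j : ℚ) / (d + 2).choose j) l +
          ε * ((W.card + 1) / ((d + 3) * (d + 2).choose b.card)) := by
      have : ((d + 2).choose b.card : ℚ) ≠ 0 := by
        exact_mod_cast (Nat.choose_pos (by omega)).ne'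
      have : (d + 3 : ℚ) ≠ 0 := by positivity
      field_simp
    rw [hg, hR]
    constructor
    · refine le_trans ?_ (add_le_add_left ih1 _)
      rw [← hsum]
      refine Finset.sum_le_sum fun A _ => div_le_div_of_nonneg_right ?_ (by positivity)
      rw [← hε']
      exact_mod_cast (hmove.eulerDefect_induced F A hl hla).1
    · intro hkl
      rw [← ih2 hkl, ← hsum]
      refine Finset.sum_congr rfl fun A _ => ?_
      -- Here `b.card ≤ k ≤ l` excludes the critical case `b.card = l + 1`.
      rw [← hε', (hmove.eulerDefect_induced F A hl hla).2 (by omega)]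
      push_cast
      rfl

end StellatedSphere

/-! ### Vertex links and their g-vectors -/

section Links

variable {V : Type*} [LinearOrder V] {M : FinComplex V}

theorem mem_faces_link {x : V} (hx : x ∈ M.vertices) {s : Finset V} :
    s ∈ (M.link x).faces ↔ x ∉ s ∧ insert x s ∈ M.faces := by
  simp only [link, Finset.mem_insert, Finset.mem_filter]
  constructor
  · rintro (rfl | h)
    · exact ⟨Finset.notMem_empty x, by simpa using mem_vertices.mp hx⟩
    · exact h.2
  · exact fun h => Or.inr ⟨M.down_closed h.2 (Finset.subset_insert _ _), h⟩

theorem vertices_link_of_isNeighbourly (hM : M.IsNeighbourly 2) {x : V} (hx : x ∈ M.vertices) :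
    (M.link x).vertices = M.vertices.erase x := by
  ext y
  rw [mem_vertices, mem_faces_link hx, Finset.mem_singleton, Finset.mem_erase]
  constructor
  · rintro ⟨h1, h2⟩
    exact ⟨Ne.symm h1, mem_vertices.mpr (M.down_closed h2 (by simp))⟩
  · rintro ⟨h1, h2⟩
    exact ⟨Ne.symm h1, hM _ (by simp [Finset.insert_subset_iff, hx, h2])
      (Finset.card_pair (Ne.symm h1))⟩

/-- Double counting of pairs of a vertex and a face of cardinality `n + 1` containing it. -/
theorem sum_numFaces_link (n : ℕ) :
    ∑ x ∈ M.vertices, (M.link x).numFaces n = (n + 1) * M.numFaces (n + 1) := by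
  have h1 : ∀ x ∈ M.vertices, (M.link x).numFaces n =
      ((M.faces.filter fun s => s.card = n + 1).filter fun s => x ∈ s).card := by
    intro x hx
    refine Finset.card_bij' (fun s _ => insert x s) (fun s _ => s.erase x) ?_ ?_ ?_ ?_
    · intro s hs
      rw [Finset.mem_filter, mem_faces_link hx] at hs
      simp only [Finset.mem_filter]
      exact ⟨⟨hs.1.2, by rw [Finset.card_insert_of_notMem hs.1.1, hs.2]⟩,
        Finset.mem_insert_self _ _⟩
    · intro s hs
      simp only [Finset.mem_filter] at hs
      rw [Finset.mem_filter, mem_faces_link hx, Finset.insert_erase hs.2,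
        Finset.card_erase_of_mem hs.2]
      exact ⟨⟨Finset.notMem_erase _ _, hs.1.1⟩, by omega⟩
    · intro s hs
      rw [Finset.mem_filter, mem_faces_link hx] at hs
      exact Finset.erase_insert hs.1.1
    · intro s hs
      exact Finset.insert_erase (Finset.mem_filter.mp hs).2
  rw [Finset.sum_congr rfl h1]
  have h2 := Finset.sum_card_bipartiteAbove_eq_sum_card_bipartiteBelow
    (s := M.vertices) (t := M.faces.filter fun s => s.card = n + 1) (fun x s => x ∈ s)
  simp only [Finset.bipartiteAbove, Finset.bipartiteBelow] at h2
  rw [h2, numFaces, mul_comm, ← smul_eq_mul, ← Finset.sum_const]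
  refine Finset.sum_congr rfl fun s hs => ?_
  rw [Finset.mem_filter] at hs
  rw [← hs.2]
  congr 1
  ext x
  rw [Finset.mem_filter, and_iff_right_iff_imp]
  exact fun hx => mem_vertices.mpr (M.down_closed hs.1 (by simpa using hx))

/-- After double counting, compare the coefficients of each face number of `M`, which has dimension
`d + 1` when its links have dimension `d`. -/
theorem sum_gNumber_link (d : ℕ) {j : ℕ} (hj : j ≤ d + 2) :
    ∑ x ∈ M.vertices, (M.link x).gNumber d j =
      (d + 3 - j) * M.gNumber (d + 1) j + (j + 1) * M.gNumber (d + 1) (j + 1) := by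
  have h1 : ∑ x ∈ M.vertices, (M.link x).gNumber d j =
      ∑ n ∈ Finset.range (j + 1), (-1) ^ (j - n) * ((d + 2 - n).choose (j - n) : ℤ) *
        ((n + 1 : ℕ) * M.numFaces (n + 1)) := by
    simp only [gNumber]
    rw [Finset.sum_comm]
    refine Finset.sum_congr rfl fun n _ => ?_
    rw [← Finset.mul_sum]
    congr 1
    exact_mod_cast sum_numFaces_link n
  have h2 : ∑ n ∈ Finset.range (j + 1), (-1) ^ (j - n) * ((d + 2 - n).choose (j - n) : ℤ) *
        ((n + 1 : ℕ) * M.numFaces (n + 1)) =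
      ∑ n ∈ Finset.range (j + 2), (-1) ^ (j + 1 - n) * ((d + 3 - n).choose (j + 1 - n) : ℤ) *
        ((n : ℕ) * M.numFaces n) := by
    rw [Finset.sum_range_succ' _ (j + 1)]
    simp only [Nat.cast_zero, zero_mul, mul_zero, add_zero]
    refine Finset.sum_congr rfl fun n _ => ?_
    rw [Nat.add_sub_add_right, show d + 3 - (n + 1) = d + 2 - n by omega]
  rw [h1, h2, gNumber, gNumber, Finset.sum_range_succ _ (j + 1), Finset.sum_range_succ _ (j + 1),
    mul_add, ← add_assoc, Finset.mul_sum, Finset.mul_sum, ← Finset.sum_add_distrib]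
  congr 1
  · refine Finset.sum_congr rfl fun n hn => ?_
    rw [Finset.mem_range] at hn
    obtain ⟨r, rfl⟩ := Nat.exists_eq_add_of_le (show n ≤ j by omega)
    obtain ⟨e, he⟩ := Nat.exists_eq_add_of_le hj
    have he' : (d : ℤ) + 3 - (n + r : ℕ) = e + 1 := by push_cast; omega
    have hchoose : (((r + e + 1).choose (r + 1) : ℕ) : ℤ) * (r + 1) =
        (r + e + 1).choose r * (e + 1) := by
      have := Nat.choose_succ_right_eq (r + e + 1) r
      rw [show r + e + 1 - r = e + 1 by omega] at this
      exact_mod_cast this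
    rw [he', show d + 3 - n = r + e + 1 by omega,
      show n + r + 1 - n = r + 1 by omega, Nat.add_sub_cancel_left, pow_succ]
    push_cast
    linear_combination (-1) ^ r * (M.numFaces n : ℤ) * hchoose
  · simp

end Links

/-! ### From links to the mu-vector -/

section MuVector

variable {V : Type*} [LinearOrder V] (F : Type*) [Field F] {M : FinComplex V}

theorem gNumber_zero (d : ℕ) : M.gNumber d 0 = 1 := by
  rw [gNumber, Finset.sum_range_one, numFaces, filter_card_eq_zero]
  simp

theorem alternatingSum_muVec (l : ℕ) :
    alternatingSum (fun i => M.muVec F (i + 1)) l =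
      (-1) ^ l + 1 / M.vertices.card *
        ∑ x ∈ M.vertices, alternatingSum ((M.link x).sigmaVec F) l := by
  have h : ∀ i, M.muVec F (i + 1) = (if i = 0 then 1 else 0) +
      1 / M.vertices.card * ∑ x ∈ M.vertices, (M.link x).sigmaVec F i := by
    intro i
    simp [muVec]
  simp only [h]
  rw [alternatingSum_add, alternatingSum_single, alternatingSum_mul_left, alternatingSum_sum]
  simp

/-- Dividing by `(d + 2).choose j` turns the coefficients `d + 3 - j` and `j + 1` into `d + 3` over
the binomials for `j` and `j + 1`, so the alternating sum telescopes. The remaining `(-1) ^ l` comes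
from `g_0 = 1`. -/
theorem sum_alternatingSum_gNumber_link {d l : ℕ} (hl : l ≤ d + 1) :
    ∑ x ∈ M.vertices,
        alternatingSum (fun j => ((M.link x).gNumber d j : ℚ) / (d + 2).choose j) l =
      (d + 3) * ((M.gNumber (d + 1) (l + 1) : ℚ) / (d + 3).choose (l + 1) + (-1) ^ l) := by
  have h := alternatingSum_add_succ
    (fun j => (M.gNumber (d + 1) j : ℚ) / (d + 3).choose j) l
  rw [gNumber_zero, Nat.choose_zero_right] at h
  simp only [Int.cast_one, Nat.cast_one, div_one, mul_one] at h
  rw [← alternatingSum_sum, ← h, ← alternatingSum_mul_left]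
  refine alternatingSum_congr fun j hj => ?_
  have h1 : ∑ x ∈ M.vertices, ((M.link x).gNumber d j : ℚ) =
      (d + 3 - j) * M.gNumber (d + 1) j + (j + 1) * M.gNumber (d + 1) (j + 1) := by
    exact_mod_cast congrArg (Int.cast : ℤ → ℚ) (sum_gNumber_link (M := M) d (j := j) (by omega))
  have h2 : ((d + 2).choose j : ℚ) * (d + 3) = (d + 3).choose j * (d + 3 - j) := by
    have := congrArg (Nat.cast : ℕ → ℚ) (Nat.choose_mul_succ_eq (d + 2) j)
    rw [Nat.cast_mul, Nat.cast_mul, Nat.cast_sub (by omega)] at this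
    push_cast at this
    rw [show (d + 2 + 1 : ℚ) = d + 3 by ring] at this
    exact this
  have h3 : (d + 3 : ℚ) * (d + 2).choose j = (d + 3).choose (j + 1) * (j + 1) := by
    exact_mod_cast Nat.add_one_mul_choose_eq (d + 2) j
  have p1 : ((d + 2).choose j : ℚ) ≠ 0 := by exact_mod_cast (Nat.choose_pos (by omega)).ne'
  have p2 : ((d + 3).choose j : ℚ) ≠ 0 := by exact_mod_cast (Nat.choose_pos (by omega)).ne'
  have p3 : ((d + 3).choose (j + 1) : ℚ) ≠ 0 := by exact_mod_cast (Nat.choose_pos (by omega)).ne'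
  rw [← Finset.sum_div, h1, add_div, mul_add]
  congr 1
  · field_simp
    linear_combination -(M.gNumber (d + 1) j : ℚ) * h2
  · field_simp
    linear_combination -(M.gNumber (d + 1) (j + 1) : ℚ) * h3

variable {k d : ℕ}

theorem card_vertices_link_add_one (hM : M.IsNeighbourly 2) {x : V} (hx : x ∈ M.vertices) :
    ((M.link x).vertices.card + 1 : ℚ) = M.vertices.card := by
  rw [vertices_link_of_isNeighbourly hM hx, ← Finset.card_erase_add_one hx]
  push_cast
  rfl

/-- Bounds for the alternating sums of sigma-numbers of the links, in terms of their
`g`-numbers, give bounds for the mu-vector in terms of the `g`-vector. -/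
theorem sum_muVec_bound (hM : M.MemW k (d + 1)) (hneigh : M.IsNeighbourly 2) {l : ℕ}
    (hld : l + 1 + k ≤ d) :
    ∑ i ∈ Finset.Icc 1 (l + 1), (-1 : ℚ) ^ (l + 1 - i) * M.muVec F i ≤
        (M.gNumber (d + 1) (l + 2) : ℚ) / (d + 3).choose (l + 2) ∧
      (k ≤ l + 1 → ∑ i ∈ Finset.Icc 1 (l + 1), (-1 : ℚ) ^ (l + 1 - i) * M.muVec F i =
        (M.gNumber (d + 1) (l + 2) : ℚ) / (d + 3).choose (l + 2)) := by
  have hm : (0 : ℚ) < M.vertices.card := by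
    exact_mod_cast Finset.card_pos.mpr hM.connected.1
  have hlink := fun x (hx : x ∈ M.vertices) =>
    (hM.stellated_link x hx).sum_eulerDefect_le F (l := l + 1) (by omega) hld _ subset_rfl
  have hsum : ∑ x ∈ M.vertices, ((M.link x).vertices.card + 1 : ℚ) / (d + 3) *
        alternatingSum (fun j => ((M.link x).gNumber d j : ℚ) / (d + 2).choose j) (l + 1) =
      M.vertices.card * ((M.gNumber (d + 1) (l + 2) : ℚ) / (d + 3).choose (l + 2) -
        (-1) ^ l) := by
    -- Neighbourliness makes the factor `(M.link x).vertices.card + 1` the same for all `x`, so it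
    -- can be taken out of the sum.
    rw [Finset.sum_congr rfl fun x hx => by rw [card_vertices_link_add_one hneigh hx],
      ← Finset.mul_sum, sum_alternatingSum_gNumber_link (by omega), pow_succ]
    have : (d + 3 : ℚ) ≠ 0 := by positivity
    field_simp
    ring
  rw [sum_Icc_neg_one_pow_mul, alternatingSum_muVec]
  simp only [alternatingSum_sigmaVec]
  constructor
  · have h := Finset.sum_le_sum fun x hx => (hlink x hx).1
    rw [Nat.add_sub_cancel, hsum] at h
    rw [one_div, ← le_sub_iff_add_le', inv_mul_le_iff₀ hm]
    exact h
  · intro hkl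
    have h := Finset.sum_congr rfl fun x hx => (hlink x hx).2 hkl
    rw [Nat.add_sub_cancel, hsum] at h
    rw [h]
    field_simp
    ring

theorem muVec_eq_zero (hM : M.MemW k (d + 1)) {i : ℕ} (hk : 1 ≤ k) (hki : k ≤ i)
    (hid : i + 1 + k ≤ d) : M.muVec F (i + 1) = 0 := by
  obtain ⟨i, rfl⟩ : ∃ j, i = j + 1 := ⟨i - 1, by omega⟩
  rw [muVec, if_neg (by omega), zero_add, Finset.sum_eq_zero, mul_zero]
  intro x hx
  refine Finset.sum_eq_zero fun j _ => ?_
  rw [Finset.sum_eq_zero, mul_zero]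
  intro A _
  rw [reducedBetti_succ, (hM.stellated_link x hx).eulerDefect_add_eq_zero F A (by omega) hki
    (by omega), Int.cast_zero]

end MuVector

end FinComplex

theorem theorem3p6 {V : Type*} [LinearOrder V] (F : Type*) [Field F] (k d : ℕ)
    (hk : 2 * k ≥ 2) (hd : d ≥ 2 * k) (M : FinComplex V) (hM : M.MemW k d)
    (hneigh : M.IsNeighbourly 2) :
    (∀ i : ℕ, k + 1 ≤ i → i ≤ d - k - 1 → M.muVec F i = 0) ∧
    (∀ l : ℕ, 1 ≤ l → l ≤ k - 1 →
      ∑ i ∈ Finset.Icc 1 l, (-1 : ℚ) ^ (l - i) * M.muVec F i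
        ≤ (M.gNumber d (l + 1) : ℚ) / ((d + 2).choose (l + 1) : ℚ)) ∧
    (∀ l : ℕ, k ≤ l → l ≤ d - k - 1 →
      ∑ i ∈ Finset.Icc 1 l, (-1 : ℚ) ^ (l - i) * M.muVec F i
        = (M.gNumber d (l + 1) : ℚ) / ((d + 2).choose (l + 1) : ℚ)) := by
  -- Afterwards `d` is the dimension of the links.
  obtain ⟨d, rfl⟩ : ∃ e, d = e + 1 := ⟨d - 1, by omega⟩
  refine ⟨fun i hki hid => ?_, fun l hl hlk => ?_, fun l hkl hld => ?_⟩
  · obtain ⟨i, rfl⟩ : ∃ j, i = j + 1 := ⟨i - 1, by omega⟩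
    exact FinComplex.muVec_eq_zero F hM (by omega) (by omega) (by omega)
  · obtain ⟨l, rfl⟩ : ∃ j, l = j + 1 := ⟨l - 1, by omega⟩
    exact (FinComplex.sum_muVec_bound F hM hneigh (by omega)).1
  · obtain ⟨l, rfl⟩ : ∃ j, l = j + 1 := ⟨l - 1, by omega⟩
    exact (FinComplex.sum_muVec_bound F hM hneigh (by omega)).2 hkl
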